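/- **Theorem 4.1.** Let $\chi(d)=\left(\frac{2}{d}\right)$ be the Jacobi symbol. For $n\in\mathbb{Z}$ let $r_1(n)=\#\{x\in\mathbb{Z}: x^2=n\}$. For $m\in\mathbb{Z}$ put $t_m=\frac{m\pi}{2\log(1+\sqrt2)}$. Let $\eta$ be the Hecke character on nonzero ideals of $\mathbb{Z}[\sqrt2]$, the ring of integers of $\mathbb{Q}(\sqrt2)$ and a principal ideal domain, given by $$\eta\big((a+b\sqrt2)\big)=\operatorname{sgn}(a+b\sqrt2)\,\operatorname{sgn}(a-b\sqrt2)\,\left|\frac{a+b\sqrt2}{a-b\sqrt2}\right|^{\frac{i\pi}{2\log(1+\sqrt2)}}.$$ For $m\in\mathbb{Z}$ and a rational prime $p$ let $$\lambda_m(p)=\begin{cases}\eta(\mathfrak p)^m+\eta(\mathfrak p)^{-m}&\text{if }\chi(p)=1,\ \text{where }\mathfrak p\text{ is a prime ideal above }p,\\ 0&\text{if }\chi(p)=-1,\\ (-1)^m&\text{if }p=2,\end{cases}$$ and extend $\lambda_m$ to the positive integers by $\lambda_m(1)=1$, by $\lambda_m(p^{n+1})=\lambda_m(p)\lambda_m(p^n)-\chi(p)\lambda_m(p^{n-1})$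 for $n\ge1$, and by $\lambda_m(ab)=\lambda_m(a)\lambda_m(b)$ for $\gcd(a,b)=1$. There is a real number $\sigma_0$ such that for every integer $h\ge1$ and every $s\in\mathbb{C}$ with $\operatorname{Re}s>\sigma_0$, the series $$D_h(s)=\sum_{m\ge1}\frac{r_1(m)\,r_1(2m-h)}{m^s}$$ converges absolutely and $$D_h(s)=\sum_{m\in\mathbb{Z}}\frac{(-1)^m\lambda_m(h)}{h^s}\cdot\frac{\Gamma(s+it_m)\,\Gamma(s-it_m)}{2^{1-3s}\,\log(1+\sqrt2)\,\Gamma(2s)},$$ where the sum over $m\in\mathbb{Z}$ converges absolutely, and its term at $m=0$ equals the Eisenstein series contribution $$\frac{2^s\sqrt\pi\;\Gamma(s)}{\log(1+\sqrt2)\,h^s\,\Gamma(s+\frac12)}\sum_{d\mid h}\chi(d).$$ Moreover, for all $m\in\mathbb{Z}$ and $h\ge1$ there are only finitely many ideals $\mathfrak b$ of $\mathbb{Z}[\sqrt2]$ of norm $h$, and $\lambda_m(h)=\sum_{N(\mathfrak b)=h}\eta(\mathfrak b)^m$, the $h$-th Fourier coefficient of the dihedral form attached to $\eta^m$. -/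

import Mathlib

open scoped BigOperators

noncomputable section

namespace DihedralSeries

/-! ### The ring of integers `ℤ[√2]` of `ℚ(√2)` is a principal ideal domain -/

instance nonsquare_two : Zsqrtd.Nonsquare 2 :=
  ⟨fun n h => by
    rcases Nat.lt_or_ge n 2 with h2 | h2
    · interval_cases n <;> omega
    · nlinarith⟩

instance isDomain_zsqrt2 : IsDomain (ℤ√2) :=
  inferInstanceAs (IsDomain (ℤ√((2 : ℕ) : ℤ)))

theorem norm_ne_zero {b : ℤ√2} (hb : b ≠ 0) : b.norm ≠ 0 := fun h =>
  hb ((Zsqrtd.norm_eq_zero (fun n hn => by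
    have h1 : n < 2 := by nlinarith
    have h2 : -2 < n := by nlinarith
    interval_cases n <;> omega) b).1 h)

theorem exists_near (u N : ℤ) (hN : N ≠ 0) : ∃ q : ℤ, 4 * (u - N * q) ^ 2 ≤ N ^ 2 := by
  refine ⟨round ((u : ℚ) / N), ?_⟩
  have hN' : (N : ℚ) ≠ 0 := by exact_mod_cast hN
  have h := abs_sub_round ((u : ℚ) / N)
  have h2 := sq_le_sq' (abs_le.1 h).1 (abs_le.1 h).2
  have h3 : (u : ℚ) - N * round ((u : ℚ) / N) = N * ((u : ℚ) / N - round ((u : ℚ) / N)) := by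
    field_simp
  have h4 : 4 * ((u : ℚ) - N * round ((u : ℚ) / N)) ^ 2 ≤ (N : ℚ) ^ 2 := by
    rw [h3, mul_pow]
    nlinarith [sq_nonneg (N : ℚ)]
  exact_mod_cast h4

theorem exists_quotient (a : ℤ√2) {b : ℤ√2} (hb : b ≠ 0) :
    ∃ q : ℤ√2, (a - b * q).norm.natAbs < b.norm.natAbs := by
  have hN := norm_ne_zero hb
  obtain ⟨q₁, h₁⟩ := exists_near (a * star b).re b.norm hN
  obtain ⟨q₂, h₂⟩ := exists_near (a * star b).im b.norm hN
  refine ⟨⟨q₁, q₂⟩, ?_⟩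
  have key : (a - b * ⟨q₁, q₂⟩).norm * b.norm
      = ((a * star b).re - b.norm * q₁) ^ 2 - 2 * ((a * star b).im - b.norm * q₂) ^ 2 := by
    simp only [Zsqrtd.norm_def, Zsqrtd.re_mul, Zsqrtd.im_mul, Zsqrtd.re_sub, Zsqrtd.im_sub,
      Zsqrtd.re_star, Zsqrtd.im_star]
    ring
  have hpos : 0 < b.norm ^ 2 := by positivity
  have hlt : |(a - b * ⟨q₁, q₂⟩).norm * b.norm| < b.norm ^ 2 := by
    rw [key, abs_lt]
    constructor <;>
      nlinarith [sq_nonneg ((a * star b).re - b.norm * q₁),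
        sq_nonneg ((a * star b).im - b.norm * q₂)]
  rw [abs_mul, ← sq_abs b.norm, sq] at hlt
  zify
  exact lt_of_mul_lt_mul_right hlt (abs_nonneg _)

instance isPrincipalIdealRing_zsqrt2 : IsPrincipalIdealRing (ℤ√2) := by
  classical
  refine ⟨fun I => ?_⟩
  by_cases hI : I = ⊥
  · subst hI
    infer_instance
  obtain ⟨b₀, hb₀, hb₀0⟩ := Submodule.exists_mem_ne_zero_of_ne_bot hI
  have hex : ∃ n : ℕ, ∃ b : ℤ√2, b ∈ I ∧ b ≠ 0 ∧ b.norm.natAbs = n := ⟨_, b₀, hb₀, hb₀0, rfl⟩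
  obtain ⟨b, hbI, hb0, hbn⟩ := Nat.find_spec hex
  refine ⟨⟨b, le_antisymm (fun a ha => ?_) ?_⟩⟩
  · obtain ⟨q, hq⟩ := exists_quotient a hb0
    have hmem : a - b * q ∈ I := I.sub_mem ha (I.mul_mem_right q hbI)
    by_cases h0 : a - b * q = 0
    · exact Ideal.mem_span_singleton'.2 ⟨q, by rw [mul_comm]; exact (sub_eq_zero.1 h0).symm⟩
    · exact absurd ⟨_, hmem, h0, rfl⟩ (Nat.find_min hex (by rw [← hbn]; exact hq))
  · exact (Ideal.span_singleton_le_iff_mem I).2 hbI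

/-! ### The Hecke character -/

/-- The real number `t_m = mπ / (2 log(1 + √2))`. -/
def specParam (m : ℤ) : ℝ := m * Real.pi / (2 * Real.log (1 + √2))

/-- `sgn(α) sgn(α') |α / α'| ^ (iπ / (2 log(1 + √2)))` for `α = a + b√2` with conjugate
`α' = a - b√2`. -/
def etaElt (α : ℤ√2) : ℂ :=
  ((SignType.sign ((α.re : ℝ) + α.im * √2) : ℝ) : ℂ) *
    ((SignType.sign ((α.re : ℝ) - α.im * √2) : ℝ) : ℂ) *
    (((|((α.re : ℝ) + α.im * √2) / ((α.re : ℝ) - α.im * √2)| : ℝ) : ℂ) ^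
      (Complex.I * Real.pi / (2 * Real.log (1 + √2))))

/-- The Hecke character `η` of `ℚ(√2)` on ideals of `ℤ[√2]`: the value of `etaElt` at a generator.
(On nonzero ideals the value does not depend on the generator.) -/
def eta (𝔟 : Ideal (ℤ√2)) : ℂ := etaElt (Submodule.IsPrincipal.generator 𝔟)

/-- The quadratic character `χ(d) = (2/d)`, for positive integers `d`. -/
def chi (d : ℕ) : ℤ := jacobiSym 2 d

theorem exists_prime_over {p : ℕ} (hp : p.Prime) :
    ∃ P : Ideal (ℤ√2), P.IsPrime ∧ (p : ℤ√2) ∈ P := by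
  have hne : Ideal.span {(p : ℤ√2)} ≠ ⊤ := by
    rw [Ne, Ideal.span_singleton_eq_top, ← Zsqrtd.norm_eq_one_iff, Zsqrtd.norm_natCast]
    intro h
    rw [Int.natAbs_mul, Int.natAbs_natCast] at h
    exact hp.one_lt.ne' (Nat.eq_one_of_mul_eq_one_left h)
  obtain ⟨M, hM, hle⟩ := Ideal.exists_le_maximal _ hne
  exact ⟨M, hM.isPrime, hle (Ideal.mem_span_singleton_self _)⟩

/-- A prime ideal of `ℤ[√2]` above the rational prime `p` (and `⊥` if `p` is not prime). -/
def primeOver (p : ℕ) : Ideal (ℤ√2) :=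
  if hp : p.Prime then Classical.choose (exists_prime_over hp) else ⊥

/-! ### The eigenvalues `λ_m` -/

/-- `λ_m(p)` at a rational prime `p`. -/
def lamPrime (m : ℤ) (p : ℕ) : ℂ :=
  if p = 2 then (-1) ^ m
  else if chi p = 1 then eta (primeOver p) ^ m + eta (primeOver p) ^ (-m)
  else 0

/-- `λ_m(p ^ k)` at a prime power, by the Hecke recursion. -/
def lamPrimePow (m : ℤ) (p : ℕ) : ℕ → ℂ
  | 0 => 1
  | 1 => lamPrime m p
  | k + 2 => lamPrime m p * lamPrimePow m p (k + 1) - (chi p : ℂ) * lamPrimePow m p k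

/-- `λ_m(h)` for `h ≥ 1`, the multiplicative extension of its values at prime powers. -/
def lam (m : ℤ) (h : ℕ) : ℂ := h.factorization.prod fun p k => lamPrimePow m p k

/-! ### The Dirichlet series -/

/-- `r₁(n)`: the number of representations of `n` as the square of an integer. -/
def r1 (n : ℤ) : ℕ := {x : ℤ | x ^ 2 = n}.ncard

/-- The `m`-th term of `D_h(s)`. -/
def seriesTerm (h : ℕ) (s : ℂ) (m : ℕ+) : ℂ :=
  (r1 ((m : ℕ) : ℤ) : ℂ) * (r1 (2 * ((m : ℕ) : ℤ) - (h : ℤ)) : ℂ) / ((m : ℕ) : ℂ) ^ s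

/-- `D_h(s) = ∑_{m ≥ 1} r₁(m) r₁(2m - h) / m ^ s`. -/
def D (h : ℕ) (s : ℂ) : ℂ := ∑' m : ℕ+, seriesTerm h s m

/-- The `m`-th term of the spectral expansion of `D_h(s)`. -/
def spectralTerm (h : ℕ) (s : ℂ) (m : ℤ) : ℂ :=
  ((-1) ^ m * lam m h / (h : ℂ) ^ s) *
    (Complex.Gamma (s + Complex.I * specParam m) * Complex.Gamma (s - Complex.I * specParam m) /
      (2 ^ (1 - 3 * s) * Real.log (1 + √2) * Complex.Gamma (2 * s)))

end DihedralSeries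

end

/-!
# Dirichlet series of squares and the Hecke characters of `ℚ(√2)`

A pair of squares `x² = m`, `y² = 2m - h` is an element `α = y + x√2` of `ℤ[√2]` of norm `-h`, so
`D_h(s) = ∑ |x| ^ (-2s)` over all elements of norm `-h` (`hasSum_seriesTerm`). On the hyperbola of
norm `-h` one has `2x² = h cosh² u` with `u = ½ log |α / α'|` (`im_sq_eq`). The elements of
norm `-h` generating a given ideal are `±(1 + √2) ^ (2k) α` (`exists_equiv_elements`, which rests
on the solution of Pell's equation), and multiplication by `(1 + √2) ^ (2k)` translates `u` by
`kL`, where `L = 2 log(1 + √2)`. So each ideal of norm `h` contributes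
`2 (h / 2) ^ (-s) ∑ₖ cosh(u + kL) ^ (-2s)`.

Poisson summation (`hasSum_fourier_sechPow`) turns this sum over `k` into a sum over frequencies
`m`. The Fourier transform of a power of the hyperbolic secant is a beta integral
(`fourier_sechPow`), which gives the two gamma factors, and the character `exp(2πimu / L)` equals
`(-1) ^ m η ^ m` (`exp_halfLog_eq`). The recurrence `Γ(z + 1) = z Γ(z)` shows that the frequency
side decays quadratically (`summable_Gamma_mul_Gamma`), as Poisson summation requires.

It remains to identify `∑ η(𝔟) ^ m`, over the ideals of norm `h`, with `λ_m(h)`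
(`lam_eq_idealSum`). Both obey the Hecke relations at each prime `p`. For the ideal sum, an ideal of
norm `p h` is divisible by a prime above `p`: there is only one if `p` is ramified or inert, and
for split `p = 𝔭𝔮` one counts multiples of `𝔭` and of `𝔮` and subtracts the multiples of `𝔭𝔮`.
-/

open scoped BigOperators

namespace DihedralSeries

/-! ### The real places and the units of `ℤ[√2]` -/

/-- The real embedding `a + b√2 ↦ a + b√2` of `ℤ[√2]`. -/
noncomputable def place₁ : ℤ√2 →+* ℝ := Zsqrtd.lift ⟨√2, by norm_num⟩

/-- The real embedding `a + b√2 ↦ a - b√2` of `ℤ[√2]`. -/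
noncomputable def place₂ : ℤ√2 →+* ℝ := Zsqrtd.lift ⟨-√2, by norm_num⟩

theorem place₁_apply (α : ℤ√2) : place₁ α = (α.re : ℝ) + α.im * √2 := by
  simp [place₁]

theorem place₂_apply (α : ℤ√2) : place₂ α = (α.re : ℝ) - α.im * √2 := by
  simp [place₂, sub_eq_add_neg]

theorem place_mul_place (α : ℤ√2) : place₁ α * place₂ α = (α.norm : ℝ) := by
  rw [place₁_apply, place₂_apply, Zsqrtd.norm_def]
  push_cast
  linear_combination (-(α.im : ℝ) ^ 2) * Real.mul_self_sqrt (show (0 : ℝ) ≤ 2 by norm_num)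

theorem place₁_ne_zero {α : ℤ√2} (hα : α ≠ 0) : place₁ α ≠ 0 := fun h => by
  have := place_mul_place α
  rw [h, zero_mul] at this
  exact norm_ne_zero hα (by exact_mod_cast this.symm)

theorem place₂_ne_zero {α : ℤ√2} (hα : α ≠ 0) : place₂ α ≠ 0 := fun h => by
  have := place_mul_place α
  rw [h, mul_zero] at this
  exact norm_ne_zero hα (by exact_mod_cast this.symm)

theorem etaElt_eq (α : ℤ√2) : etaElt α =
    ((SignType.sign (place₁ α) : ℝ) : ℂ) * ((SignType.sign (place₂ α) : ℝ) : ℂ) *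
      (((|place₁ α / place₂ α| : ℝ) : ℂ) ^
        (Complex.I * Real.pi / (2 * Real.log (1 + √2)))) := by
  rw [place₁_apply, place₂_apply, etaElt]

theorem etaElt_mul (α β : ℤ√2) : etaElt (α * β) = etaElt α * etaElt β := by
  simp only [etaElt_eq, map_mul, sign_mul, mul_div_mul_comm, abs_mul]
  rw [Complex.ofReal_mul |place₁ α / place₂ α|,
    Complex.mul_cpow_ofReal_nonneg (abs_nonneg _) (abs_nonneg _)]
  push_cast
  ring

/-- The fundamental unit `1 + √2`, of norm `-1`. -/
def fundUnit : (ℤ√2)ˣ := ⟨⟨1, 1⟩, ⟨-1, 1⟩, by decide, by decide⟩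

theorem log_one_add_sqrt_two_pos : 0 < Real.log (1 + √2) :=
  Real.log_pos (by linarith [Real.sqrt_pos.2 (show (0 : ℝ) < 2 by norm_num)])

theorem place₁_fundUnit : place₁ fundUnit = 1 + √2 := by
  simp [place₁_apply, fundUnit]

theorem abs_place₂_fundUnit : |place₂ fundUnit| = (1 + √2)⁻¹ := by
  have h : place₁ fundUnit * place₂ fundUnit = -1 := by
    rw [place_mul_place]; norm_num [fundUnit, Zsqrtd.norm_def]
  have hp : 0 < 1 + √2 := by positivity
  rw [place₁_fundUnit] at h
  have h2 := congrArg abs h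
  rw [abs_mul, abs_of_pos hp, abs_neg, abs_one] at h2
  exact eq_inv_of_mul_eq_one_right h2

theorem etaElt_of_norm_neg {α : ℤ√2} (hα : α.norm < 0) : etaElt α =
    -Complex.exp (Complex.I * Real.pi / (2 * Real.log (1 + √2)) *
      Real.log |place₁ α / place₂ α|) := by
  have hα0 : α ≠ 0 := by rintro rfl; simp at hα
  have h : place₁ α * place₂ α < 0 := by
    rw [place_mul_place]; exact_mod_cast hα
  have h1 : 0 < |place₁ α / place₂ α| :=
    abs_pos.2 (div_ne_zero (place₁_ne_zero hα0) (place₂_ne_zero hα0))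
  rw [etaElt_eq, ← Complex.ofReal_mul, Complex.cpow_def_of_ne_zero (by exact_mod_cast h1.ne'),
    ← Complex.ofReal_log h1.le, mul_comm (Complex.ofReal (Real.log _))]
  rcases mul_neg_iff.1 h with ⟨h2, h3⟩ | ⟨h2, h3⟩ <;> simp [sign_pos, sign_neg, h2, h3]

theorem etaElt_one : etaElt 1 = 1 := by simp [etaElt_eq]

theorem etaElt_neg_one : etaElt (-1) = 1 := by simp [etaElt_eq]

theorem log_place_fundUnit :
    Real.log |place₁ fundUnit / place₂ fundUnit| = 2 * Real.log (1 + √2) := by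
  have hp : 0 < 1 + √2 := by positivity
  rw [abs_div, abs_place₂_fundUnit, place₁_fundUnit, abs_of_pos hp, div_inv_eq_mul,
    Real.log_mul hp.ne' hp.ne', two_mul]

theorem etaElt_fundUnit : etaElt fundUnit = 1 := by
  rw [etaElt_of_norm_neg (by norm_num [fundUnit, Zsqrtd.norm_def]), log_place_fundUnit]
  have h : (Real.log (1 + √2) : ℂ) ≠ 0 := by exact_mod_cast log_one_add_sqrt_two_pos.ne'
  have : Complex.I * Real.pi / (2 * Real.log (1 + √2)) * ((2 * Real.log (1 + √2) : ℝ) : ℂ)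
      = Real.pi * Complex.I := by
    push_cast
    field_simp
  rw [this, Complex.exp_pi_mul_I, neg_neg]

/-- The unit `3 + 2√2` as a solution of the Pell equation `x² - 2y² = 1`. -/
def pellUnit : Pell.Solution₁ 2 := Pell.Solution₁.mk 3 2 (by norm_num)

theorem isFundamental_pellUnit : Pell.IsFundamental pellUnit := by
  refine ⟨by simp [pellUnit], by simp [pellUnit], fun {b} hb => ?_⟩
  by_contra! h
  have hx : b.x = 2 := by
    have : pellUnit.x = 3 := by simp [pellUnit]
    omega
  have := b.prop
  rw [hx] at this
  omega

/-- A solution `(x, y)` of the Pell equation, viewed as the unit `x + y√2`. -/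
def pellToUnits : Pell.Solution₁ 2 →* (ℤ√2)ˣ := Unitary.toUnits

theorem pellToUnits_pellUnit : pellToUnits pellUnit = fundUnit ^ 2 := by
  ext <;> rfl

theorem norm_fundUnit : (fundUnit : ℤ√2).norm = -1 := by
  norm_num [fundUnit, Zsqrtd.norm_def]

/-- Units of norm `1` are `±(1 + √2) ^ (2k)`: this is the structure of the solutions of the Pell
equation `x² - 2y² = 1`. -/
theorem unit_eq_of_norm_one (u : (ℤ√2)ˣ) (hu : (u : ℤ√2).norm = 1) :
    ∃ k : ℤ, u = (fundUnit ^ 2) ^ k ∨ u = -(fundUnit ^ 2) ^ k := by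
  have hmem : (u : ℤ√2) ∈ unitary (ℤ√2) := Pell.is_pell_solution_iff_mem_unitary.1 (by
    rw [Zsqrtd.norm_def] at hu; linarith)
  obtain ⟨k, hk⟩ := isFundamental_pellUnit.eq_zpow_or_neg_zpow ⟨u, hmem⟩
  have hval : pellToUnits ⟨u, hmem⟩ = u := by
    ext <;> rfl
  refine ⟨k, hk.imp (fun h => ?_) (fun h => ?_)⟩
  · rw [← hval, ← pellToUnits_pellUnit, ← map_zpow]
    exact congrArg _ h
  · rw [← hval, ← pellToUnits_pellUnit, ← map_zpow]
    ext1
    exact congrArg Subtype.val h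

theorem etaElt_fundUnit_zpow (k : ℤ) : etaElt ((fundUnit ^ k : (ℤ√2)ˣ) : ℤ√2) = 1 := by
  let f : ℤ√2 →* ℂ := ⟨⟨etaElt, etaElt_one⟩, etaElt_mul⟩
  have h : Units.map f fundUnit = 1 := Units.ext etaElt_fundUnit
  have h2 : Units.map f (fundUnit ^ k) = 1 := by rw [map_zpow, h, one_zpow]
  exact congrArg Units.val h2

theorem etaElt_unit (u : (ℤ√2)ˣ) : etaElt u = 1 := by
  have key : ∀ v : (ℤ√2)ˣ, (v : ℤ√2).norm = 1 → etaElt v = 1 := by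
    intro v hv
    obtain ⟨k, rfl | rfl⟩ := unit_eq_of_norm_one v hv
    · rw [← zpow_natCast, ← zpow_mul, etaElt_fundUnit_zpow]
    · rw [Units.val_neg, ← neg_one_mul, etaElt_mul, etaElt_neg_one, ← zpow_natCast, ← zpow_mul,
        etaElt_fundUnit_zpow, one_mul]
  have hn : ((u : ℤ√2).norm).natAbs = 1 := Zsqrtd.norm_eq_one_iff.2 u.isUnit
  rcases Int.natAbs_eq (u : ℤ√2).norm with h | h
  · exact key u (by rw [h, hn]; rfl)
  · have h2 := key (u * fundUnit) (by
      rw [Units.val_mul, Zsqrtd.norm_mul, norm_fundUnit, h, hn]; rfl)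
    rwa [Units.val_mul, etaElt_mul, etaElt_fundUnit, mul_one] at h2

theorem etaElt_eq_of_associated {α β : ℤ√2} (h : Associated α β) : etaElt α = etaElt β := by
  obtain ⟨u, rfl⟩ := h
  rw [etaElt_mul, etaElt_unit, mul_one]

theorem eta_span (α : ℤ√2) : eta (Ideal.span {α}) = etaElt α :=
  etaElt_eq_of_associated (Ideal.span_singleton_eq_span_singleton.1
    (Ideal.span_singleton_generator _))

theorem eta_mul (I J : Ideal (ℤ√2)) : eta (I * J) = eta I * eta J := by
  rw [← Ideal.span_singleton_generator I, ← Ideal.span_singleton_generator J,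
    Ideal.span_singleton_mul_span_singleton, eta_span, eta_span, eta_span, etaElt_mul]

/-! ### Norms of ideals -/

/-- The `ℤ`-basis `1, √2` of `ℤ[√2]`. -/
noncomputable def intBasis : Module.Basis (Fin 2) ℤ (ℤ√2) := Module.Basis.ofEquivFun
  { toFun := fun α => ![α.re, α.im]
    invFun := fun v => ⟨v 0, v 1⟩
    map_add' := fun α β => by ext i; fin_cases i <;> simp
    map_smul' := fun n α => by ext i; fin_cases i <;> simp
    left_inv := fun α => by ext <;> simp
    right_inv := fun v => by ext i; fin_cases i <;> simp }

instance : Module.Free ℤ (ℤ√2) := Module.Free.of_basis intBasis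

instance : Module.Finite ℤ (ℤ√2) := Module.Finite.of_basis intBasis

theorem algebraNorm_eq (α : ℤ√2) : Algebra.norm ℤ α = α.norm := by
  rw [Algebra.norm_eq_matrix_det intBasis, Matrix.det_fin_two]
  simp [Algebra.leftMulMatrix_eq_repr_mul, intBasis, Zsqrtd.norm_def]

theorem absNorm_span (α : ℤ√2) : Ideal.absNorm (Ideal.span {α}) = α.norm.natAbs := by
  rw [Ideal.absNorm_span_singleton, algebraNorm_eq]

/-- The ideals of norm `h`. -/
def idealsOfNorm (h : ℕ) : Set (Ideal (ℤ√2)) := {I | Nat.card (ℤ√2 ⧸ I) = h}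

theorem mem_idealsOfNorm {h : ℕ} {I : Ideal (ℤ√2)} :
    I ∈ idealsOfNorm h ↔ Ideal.absNorm I = h := Iff.rfl

theorem span_mem_idealsOfNorm {h : ℕ} {α : ℤ√2} :
    Ideal.span {α} ∈ idealsOfNorm h ↔ α.norm.natAbs = h := by
  rw [mem_idealsOfNorm, absNorm_span]

theorem finite_idealsOfNorm (h : ℕ) : (idealsOfNorm h).Finite :=
  Ideal.finite_setOfPred_absNorm_eq h

/-! ### Multiplicative functions with the Hecke recursion -/

theorem lam_prime_pow_mul (m : ℤ) {p n : ℕ} (hp : p.Prime) (hpn : ¬ p ∣ n) (k : ℕ) :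
    lam m (p ^ k * n) = lamPrimePow m p k * lam m n := by
  have hcop : (p ^ k).Coprime n := ((Nat.Prime.coprime_iff_not_dvd hp).2 hpn).pow_left k
  rw [lam, Nat.factorization_mul_of_coprime hcop,
    Finsupp.prod_add_index_of_disjoint (Nat.Coprime.disjoint_primeFactors hcop),
    hp.factorization_pow, Finsupp.prod_single_index rfl, lam]

/-- The Hecke recursion at prime powers and compatibility with coprime factors characterize
`λ_m`. -/
theorem lam_eq_of_prime_pow_mul (m : ℤ) (f : ℕ → ℂ) (h1 : f 1 = 1)
    (hf : ∀ (p n k : ℕ), p.Prime → ¬ p ∣ n → f (p ^ k * n) = lamPrimePow m p k * f n)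
    {h : ℕ} (hh : h ≠ 0) : lam m h = f h := by
  induction h using Nat.recOnPrimePow with
  | zero => exact absurd rfl hh
  | one => rw [h1]; simp [lam]
  | prime_pow_mul a p n hp hpa _ ih =>
    rw [lam_prime_pow_mul m hp hpa, hf p a n hp hpa, ih (right_ne_zero_of_mul hh)]

theorem chi_mul {a b : ℕ} (ha : a ≠ 0) (hb : b ≠ 0) : chi (a * b) = chi a * chi b := by
  have : NeZero a := ⟨ha⟩
  have : NeZero b := ⟨hb⟩
  exact jacobiSym.mul_right 2 a b

theorem chi_one : chi 1 = 1 := jacobiSym.one_right 2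

theorem chi_two : chi 2 = 0 := by decide +kernel

theorem chi_eq_neg_one {p : ℕ} (hp : p.Prime) (h2 : p ≠ 2) (h : chi p ≠ 1) : chi p = -1 := by
  rcases jacobiSym.trichotomy 2 p with h0 | h0 | h0
  · refine absurd h0 (jacobiSym.ne_zero ?_)
    exact (Nat.coprime_primes Nat.prime_two hp).2 h2.symm
  · exact absurd h0 h
  · exact h0

theorem chi_pow {p : ℕ} (hp : p.Prime) (k : ℕ) : chi (p ^ k) = chi p ^ k := by
  induction k with
  | zero => simp [chi_one]
  | succ k ih => rw [pow_succ, chi_mul (pow_ne_zero k hp.ne_zero) hp.ne_zero, ih, pow_succ]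

/-- `d ↦ χ(d)` as an arithmetic function. -/
def chiArith : ArithmeticFunction ℤ := ⟨fun d => if d = 0 then 0 else chi d, by simp⟩

theorem isMultiplicative_chiArith : chiArith.IsMultiplicative := by
  rw [ArithmeticFunction.IsMultiplicative.iff_ne_zero]
  refine ⟨by simp [chiArith, chi_one], fun {a b} ha hb _ => ?_⟩
  simp [chiArith, ha, hb, chi_mul ha hb]

theorem sum_chi_eq (n : ℕ) :
    ∑ d ∈ n.divisors, chi d = (chiArith * (ArithmeticFunction.zeta : ArithmeticFunction ℤ)) n := by
  rw [ArithmeticFunction.coe_mul_zeta_apply]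
  refine Finset.sum_congr rfl fun d hd => ?_
  simp [chiArith, (Nat.pos_of_mem_divisors hd).ne']

theorem sum_chi_mul {a b : ℕ} (h : a.Coprime b) : ∑ d ∈ (a * b).divisors, chi d =
    (∑ d ∈ a.divisors, chi d) * ∑ d ∈ b.divisors, chi d := by
  simp only [sum_chi_eq]
  exact (isMultiplicative_chiArith.mul
    ArithmeticFunction.isMultiplicative_zeta.natCast).map_mul_of_coprime h

theorem lamPrime_zero {p : ℕ} (hp : p.Prime) : lamPrime 0 p = 1 + chi p := by
  rw [lamPrime]
  split_ifs with h2 h1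
  · simp [h2, chi_two]
  · rw [h1]; norm_num
  · simp [chi_eq_neg_one hp h2 h1]

theorem lamPrimePow_zero {p : ℕ} (hp : p.Prime) (k : ℕ) :
    lamPrimePow 0 p k = ∑ j ∈ Finset.range (k + 1), (chi p : ℂ) ^ j := by
  induction k using Nat.twoStepInduction with
  | zero => simp [lamPrimePow]
  | one => simp [lamPrimePow, lamPrime_zero hp, Finset.sum_range_succ]
  | more k ih1 ih2 =>
    rw [lamPrimePow, ih1, ih2, lamPrime_zero hp, Finset.sum_range_succ _ (k + 2),
      Finset.sum_range_succ _ (k + 1)]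
    ring

theorem lam_zero {h : ℕ} (hh : h ≠ 0) : lam 0 h = ∑ d ∈ h.divisors, (chi d : ℂ) := by
  refine lam_eq_of_prime_pow_mul 0 (fun h => ∑ d ∈ h.divisors, (chi d : ℂ))
    (by simp [chi_one]) (fun p n k hp hpn => ?_) hh
  have hcop : (p ^ k).Coprime n := ((Nat.Prime.coprime_iff_not_dvd hp).2 hpn).pow_left k
  have := congrArg (Int.cast : ℤ → ℂ) (sum_chi_mul hcop)
  push_cast at this
  rw [this, lamPrimePow_zero hp, Nat.sum_divisors_prime_pow hp]
  simp [chi_pow hp]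

/-! ### The Hecke relations for sums over ideals of given norm -/

/-- The sum of `η ^ m` over the ideals of norm `h`. -/
noncomputable def idealSum (m : ℤ) (h : ℕ) : ℂ := ∑ᶠ I ∈ idealsOfNorm h, eta I ^ m

theorem finsum_image_mul (m : ℤ) {P : Ideal (ℤ√2)} (hP : P ≠ ⊥) (S : Set (Ideal (ℤ√2))) :
    ∑ᶠ I ∈ (P * ·) '' S, eta I ^ m = eta P ^ m * ∑ᶠ I ∈ S, eta I ^ m := by
  rw [finsum_mem_image (mul_right_injective₀ hP).injOn, mul_finsum_mem]
  simp only [eta_mul, mul_zpow]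

theorem mul_mem_idealsOfNorm {P J : Ideal (ℤ√2)} {q h : ℕ} (hP : Ideal.absNorm P = q)
    (hq : q ≠ 0) : P * J ∈ idealsOfNorm (q * h) ↔ J ∈ idealsOfNorm h := by
  rw [mem_idealsOfNorm, mem_idealsOfNorm, map_mul, hP, mul_right_inj' hq]

/-- If `P` has norm `q`, the ideals of norm `q h` divisible by `P` are the products of `P` with
the ideals of norm `h`. -/
theorem image_mul_idealsOfNorm {P : Ideal (ℤ√2)} {q : ℕ} (hP : Ideal.absNorm P = q)
    (hq : q ≠ 0) (h : ℕ) :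
    (P * ·) '' idealsOfNorm h = {I | I ∈ idealsOfNorm (q * h) ∧ P ∣ I} := by
  ext I
  constructor
  · rintro ⟨J, hJ, rfl⟩
    exact ⟨(mul_mem_idealsOfNorm hP hq).2 hJ, dvd_mul_right _ _⟩
  · rintro ⟨hI, J, rfl⟩
    exact ⟨J, (mul_mem_idealsOfNorm hP hq).1 hI, rfl⟩

theorem ne_bot_of_absNorm {P : Ideal (ℤ√2)} {q : ℕ} (hP : Ideal.absNorm P = q)
    (hq : q ≠ 0) : P ≠ ⊥ := by
  rintro rfl
  exact hq (by rw [← hP, Ideal.absNorm_bot])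

theorem idealSum_mul_of_dvd (m : ℤ) {P : Ideal (ℤ√2)} {q : ℕ} (hP : Ideal.absNorm P = q)
    (hq : q ≠ 0) {h : ℕ} (hdvd : ∀ I ∈ idealsOfNorm (q * h), P ∣ I) :
    idealSum m (q * h) = eta P ^ m * idealSum m h := by
  have : (P * ·) '' idealsOfNorm h = idealsOfNorm (q * h) := by
    rw [image_mul_idealsOfNorm hP hq]
    exact Set.sep_eq_self_iff_mem_true.2 hdvd
  rw [idealSum, ← this, finsum_image_mul m (ne_bot_of_absNorm hP hq), idealSum]

theorem dvd_norm_generator {I : Ideal (ℤ√2)} {p h : ℕ} (hI : I ∈ idealsOfNorm (p * h)) :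
    ∃ β : ℤ√2, I = Ideal.span {β} ∧ (p : ℤ) ∣ β.norm := by
  refine ⟨Submodule.IsPrincipal.generator I, (Ideal.span_singleton_generator I).symm, ?_⟩
  rw [← Ideal.span_singleton_generator I, span_mem_idealsOfNorm] at hI
  rw [← Int.dvd_natAbs, hI]
  exact ⟨h, by push_cast; ring⟩

theorem idealSum_one (m : ℤ) : idealSum m 1 = 1 := by
  have : idealsOfNorm 1 = {⊤} := by
    ext I
    rw [mem_idealsOfNorm, Ideal.absNorm_eq_one_iff, Set.mem_singleton_iff]
  rw [idealSum, this, finsum_mem_singleton, ← Ideal.span_singleton_one, eta_span, etaElt_one,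
    one_zpow]

/-! #### The ramified prime -/

theorem etaElt_sqrt_two : etaElt ⟨0, 1⟩ = -1 := by
  rw [etaElt_of_norm_neg (by norm_num [Zsqrtd.norm_def])]
  have : |place₁ ⟨0, 1⟩ / place₂ ⟨0, 1⟩| = 1 := by
    rw [place₁_apply, place₂_apply, abs_div]
    simp
  rw [this]
  simp

theorem idealSum_two_mul (m : ℤ) (h : ℕ) : idealSum m (2 * h) = (-1) ^ m * idealSum m h := by
  rw [← etaElt_sqrt_two, ← eta_span]
  refine idealSum_mul_of_dvd m (by rw [absNorm_span]; norm_num [Zsqrtd.norm_def]) two_ne_zero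
    fun I hI => ?_
  obtain ⟨β, rfl, x, hx⟩ := dvd_norm_generator hI
  rw [Ideal.span_singleton_dvd_span_singleton_iff_dvd]
  have h2 : Even (β.re * β.re) := ⟨x + β.im * β.im, by
    rw [Zsqrtd.norm_def] at hx; push_cast at hx; linarith⟩
  obtain ⟨y, hy⟩ := (Int.even_mul.1 h2).elim id id
  exact ⟨⟨β.im, y⟩, by ext <;> (simp; try omega)⟩

/-! #### Inert primes -/

theorem absNorm_span_natCast (p : ℕ) : Ideal.absNorm (Ideal.span {(p : ℤ√2)}) = p * p := by
  rw [absNorm_span, Zsqrtd.norm_natCast, Int.natAbs_mul, Int.natAbs_natCast]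

theorem etaElt_natCast {p : ℕ} (hp : p ≠ 0) : etaElt p = 1 := by
  have h : (0 : ℝ) < p := by exact_mod_cast hp.bot_lt
  simp [etaElt_eq, sign_pos h, h.ne']

theorem dvd_of_inert {p : ℕ} (hp : p.Prime) (hchi : chi p = -1) {β : ℤ√2}
    (h : (p : ℤ) ∣ β.norm) : (p : ℤ√2) ∣ β := by
  have : Fact p.Prime := ⟨hp⟩
  rw [← Int.cast_natCast, Zsqrtd.intCast_dvd]
  refine legendreSym.prime_dvd_of_eq_neg_one (a := 2) ?_ ?_
  · rw [jacobiSym.legendreSym.to_jacobiSym]; exact hchi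
  · rw [Zsqrtd.norm_def] at h
    convert h using 1; ring

theorem idealSum_inert_mul (m : ℤ) {p : ℕ} (hp : p.Prime) (hchi : chi p = -1) (h : ℕ) :
    idealSum m (p * (p * h)) = idealSum m h := by
  rw [← mul_assoc, idealSum_mul_of_dvd m (absNorm_span_natCast p)
    (mul_ne_zero hp.ne_zero hp.ne_zero), eta_span, etaElt_natCast hp.ne_zero, one_zpow, one_mul]
  intro I hI
  rw [mul_assoc] at hI
  obtain ⟨β, rfl, hβ⟩ := dvd_norm_generator hI
  exact Ideal.span_singleton_dvd_span_singleton_iff_dvd.2 (dvd_of_inert hp hchi hβ)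

theorem idealSum_inert_of_not_dvd (m : ℤ) {p : ℕ} (hp : p.Prime) (hchi : chi p = -1) {h : ℕ}
    (hh : ¬ p ∣ h) : idealSum m (p * h) = 0 := by
  have : idealsOfNorm (p * h) = ∅ := by
    refine Set.eq_empty_of_forall_notMem fun I hI => hh ?_
    obtain ⟨β, rfl, hβ⟩ := dvd_norm_generator hI
    obtain ⟨γ, rfl⟩ := dvd_of_inert hp hchi hβ
    rw [span_mem_idealsOfNorm, Zsqrtd.norm_mul, Zsqrtd.norm_natCast, Int.natAbs_mul,
      Int.natAbs_mul, Int.natAbs_natCast, mul_assoc, mul_right_inj' hp.ne_zero] at hI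
    exact ⟨_, hI.symm⟩
  rw [idealSum, this, finsum_mem_empty]

/-! #### Split primes -/

theorem primeOver_spec {p : ℕ} (hp : p.Prime) :
    (primeOver p).IsPrime ∧ (p : ℤ√2) ∈ primeOver p := by
  rw [primeOver, dif_pos hp]
  exact Classical.choose_spec (exists_prime_over hp)

theorem exists_generator_primeOver {p : ℕ} (hp : p.Prime) :
    ∃ π : ℤ√2, Prime π ∧ primeOver p = Ideal.span {π} ∧ π ∣ p := by
  obtain ⟨h1, h2⟩ := primeOver_spec hp
  have hspan := Ideal.span_singleton_generator (primeOver p)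
  have hdvd : Submodule.IsPrincipal.generator (primeOver p) ∣ (p : ℤ√2) := by
    rwa [← Ideal.mem_span_singleton, hspan]
  have h0 : Submodule.IsPrincipal.generator (primeOver p) ≠ 0 := by
    intro h
    rw [h, zero_dvd_iff] at hdvd
    have : (p : ℤ√2).norm = 0 := by rw [hdvd, Zsqrtd.norm_zero]
    rw [Zsqrtd.norm_natCast] at this
    exact hp.ne_zero (by exact_mod_cast mul_self_eq_zero.1 this)
  exact ⟨_, (Ideal.span_singleton_prime h0).1 (by rwa [hspan]), hspan.symm, hdvd⟩

theorem natAbs_norm_of_split {p : ℕ} (hp : p.Prime) (h2 : p ≠ 2) (hchi : chi p = 1) {π : ℤ√2}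
    (hπ : Prime π) (hdvd : π ∣ p) : π.norm.natAbs = p := by
  have : Fact p.Prime := ⟨hp⟩
  obtain ⟨γ, hγ⟩ := hdvd
  have hN : π.norm.natAbs * γ.norm.natAbs = p ^ 2 := by
    rw [← Int.natAbs_mul, ← Zsqrtd.norm_mul, ← hγ, Zsqrtd.norm_natCast, Int.natAbs_mul,
      Int.natAbs_natCast, sq]
  obtain ⟨k, hk, hkp⟩ := (Nat.dvd_prime_pow hp).1 ⟨_, hN.symm⟩
  interval_cases k
  · exact absurd (Zsqrtd.norm_eq_one_iff.1 (by simpa using hkp)) hπ.not_isUnit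
  · simpa using hkp
  · -- Otherwise `p` itself would be prime, although it divides `x² - 2` for some integer `x`.
    exfalso
    have hγ1 : IsUnit γ := by
      rw [← Zsqrtd.norm_eq_one_iff]
      rw [hkp] at hN
      exact Nat.eq_of_mul_eq_mul_left (pow_pos hp.pos 2) (by rw [hN, mul_one])
    have hpp : Prime (p : ℤ√2) := by
      rw [hγ]
      exact (associated_mul_unit_right π γ hγ1).prime hπ
    have hne : ((2 : ℤ) : ZMod p) ≠ 0 := by
      rw [Ne, ZMod.intCast_zmod_eq_zero_iff_dvd]
      intro h
      exact h2 ((Nat.prime_dvd_prime_iff_eq hp Nat.prime_two).1 (by exact_mod_cast h))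
    obtain ⟨x, hx⟩ := (legendreSym.eq_one_iff p hne).1 (by
      rw [jacobiSym.legendreSym.to_jacobiSym]; exact hchi)
    obtain ⟨y, rfl⟩ := ZMod.intCast_surjective x
    have hdvd : (p : ℤ) ∣ y * y - 2 := by
      rw [← ZMod.intCast_zmod_eq_zero_iff_dvd]
      push_cast at hx ⊢
      rw [← hx, sub_self]
    have h3 : (p : ℤ√2) ∣ ⟨y, 1⟩ * ⟨y, -1⟩ := by
      rw [← Int.cast_natCast, Zsqrtd.intCast_dvd]
      refine ⟨?_, by simp⟩
      convert hdvd using 1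
      simp [sub_eq_add_neg]
    have h4 : (p : ℤ) ∣ 1 := by
      rcases hpp.dvd_or_dvd h3 with h | h
      · rw [← Int.cast_natCast, Zsqrtd.intCast_dvd] at h
        exact h.2
      · rw [← Int.cast_natCast, Zsqrtd.intCast_dvd] at h
        exact (dvd_neg (b := (1 : ℤ))).1 h.2
    exact hp.one_lt.ne' (Nat.dvd_one.1 (by exact_mod_cast h4))

/-- An odd prime is unramified: a prime element above it does not divide its conjugate. -/
theorem not_star_dvd_of_split {p : ℕ} (hp : p.Prime) (h2 : p ≠ 2) {π : ℤ√2}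
    (hN : π.norm.natAbs = p) : ¬ star π ∣ π := by
  intro h
  have hpZ : Prime (p : ℤ) := Nat.prime_iff_prime_int.1 hp
  have hp2 : ¬ (p : ℤ) ∣ 2 := fun h =>
    h2 ((Nat.prime_dvd_prime_iff_eq hp Nat.prime_two).1 (by exact_mod_cast h))
  have hpN : ∀ β : ℤ√2, star π ∣ β → (p : ℤ) ∣ β.norm := by
    rintro β ⟨γ, rfl⟩
    rw [Zsqrtd.norm_mul, Zsqrtd.norm_conj, ← hN]
    exact (Int.natAbs_dvd.2 dvd_rfl).mul_right _
  have hre : (p : ℤ) ∣ π.re := by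
    have h3 := hpN _ (dvd_add h (dvd_refl (star π)))
    have h4 : (π + star π).norm = 2 * (2 * (π.re * π.re)) := by
      simp [Zsqrtd.norm_def]; ring
    rw [h4, hpZ.dvd_mul, hpZ.dvd_mul, hpZ.dvd_mul] at h3
    tauto
  have him : (p : ℤ) ∣ π.im := by
    have h3 := hpN _ (dvd_sub h (dvd_refl (star π)))
    have h4 : (π - star π).norm = -(2 * (2 * (2 * (π.im * π.im)))) := by
      simp [Zsqrtd.norm_def]; ring
    rw [h4, dvd_neg, hpZ.dvd_mul, hpZ.dvd_mul, hpZ.dvd_mul, hpZ.dvd_mul] at h3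
    tauto
  have hsq : (p : ℤ) * p ∣ p := by
    have h5 : (p : ℤ) * p ∣ π.norm := by
      rw [Zsqrtd.norm_def, mul_assoc]
      exact dvd_sub (mul_dvd_mul hre hre) ((mul_dvd_mul him him).mul_left 2)
    have := Int.dvd_natAbs.2 h5
    rwa [hN] at this
  have h6 : p * p ∣ p * 1 := by rw [mul_one]; exact_mod_cast hsq
  exact hp.one_lt.ne' (Nat.dvd_one.1 (Nat.dvd_of_mul_dvd_mul_left hp.pos h6))

/-- For a split prime `p = 𝔭𝔮`, both `𝔭` and `𝔮` have norm `p`, every ideal whose norm is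
divisible by `p` is divisible by `𝔭` or `𝔮`, and by both only if it is divisible by `𝔭𝔮`. -/
theorem exists_conj_primeOver {p : ℕ} (hp : p.Prime) (h2 : p ≠ 2) (hchi : chi p = 1) :
    ∃ Q : Ideal (ℤ√2), Ideal.absNorm (primeOver p) = p ∧ Ideal.absNorm Q = p ∧
      primeOver p * Q = Ideal.span {(p : ℤ√2)} ∧
      (∀ h, ∀ I ∈ idealsOfNorm (p * h), primeOver p ∣ I ∨ Q ∣ I) ∧
      ∀ I, primeOver p ∣ I → Q ∣ I → primeOver p * Q ∣ I := by
  obtain ⟨π, hπ, hP, hdvd⟩ := exists_generator_primeOver hp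
  have hN := natAbs_norm_of_split hp h2 hchi hπ hdvd
  have hstar : Prime (star π) :=
    (MulEquiv.prime_iff (starMulAut (R := ℤ√2))).2 hπ
  rw [hP]
  refine ⟨Ideal.span {star π}, by rw [absNorm_span, hN],
    by rw [absNorm_span, Zsqrtd.norm_conj, hN], ?_, ?_, ?_⟩
  · rw [Ideal.span_singleton_mul_span_singleton, ← Zsqrtd.norm_eq_mul_conj,
      Ideal.span_singleton_eq_span_singleton]
    rcases Int.natAbs_eq π.norm with h | h
    · rw [h, hN]; simp
    · rw [h, hN]; simp
  · intro h I hI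
    obtain ⟨β, rfl, hβ⟩ := dvd_norm_generator hI
    rw [Ideal.span_singleton_dvd_span_singleton_iff_dvd,
      Ideal.span_singleton_dvd_span_singleton_iff_dvd]
    have h3 : π ∣ β * star β := by
      rw [← Zsqrtd.norm_eq_mul_conj]
      refine hdvd.trans ?_
      rw [← Int.cast_natCast, Zsqrtd.intCast_dvd_intCast]
      exact hβ
    refine (hπ.dvd_or_dvd h3).imp id fun ⟨γ, hγ⟩ => ⟨star γ, ?_⟩
    rw [← star_star β, hγ, star_mul, mul_comm]
  · intro I hPI hQI
    obtain ⟨J, rfl⟩ := hPI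
    refine mul_dvd_mul_left _ ?_
    rw [← Ideal.span_singleton_generator J, Ideal.span_singleton_mul_span_singleton,
      Ideal.span_singleton_dvd_span_singleton_iff_dvd] at hQI
    rw [← Ideal.span_singleton_generator J, Ideal.span_singleton_dvd_span_singleton_iff_dvd]
    exact (hstar.dvd_or_dvd hQI).resolve_left (not_star_dvd_of_split hp h2 hN)

/-- Inclusion and exclusion over the two primes above a split prime. -/
theorem idealSum_split (m : ℤ) {p : ℕ} (hp : p.Prime) (h2 : p ≠ 2) (hchi : chi p = 1) (h : ℕ) :
    idealSum m (p * h) + ∑ᶠ I ∈ {I | I ∈ idealsOfNorm (p * h) ∧ Ideal.span {(p : ℤ√2)} ∣ I},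
      eta I ^ m = lamPrime m p * idealSum m h := by
  obtain ⟨Q, hP, hQ, hPQ, hor, hand⟩ := exists_conj_primeOver hp h2 hchi
  have heta : eta (primeOver p) * eta Q = 1 := by
    rw [← eta_mul, hPQ, eta_span, etaElt_natCast hp.ne_zero]
  have hunion : {I | I ∈ idealsOfNorm (p * h) ∧ primeOver p ∣ I} ∪
      {I | I ∈ idealsOfNorm (p * h) ∧ Q ∣ I} = idealsOfNorm (p * h) := by
    ext I
    have := hor h I
    simp only [Set.mem_union, Set.mem_ofPred_eq]
    tauto
  have hinter : {I | I ∈ idealsOfNorm (p * h) ∧ primeOver p ∣ I} ∩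
      {I | I ∈ idealsOfNorm (p * h) ∧ Q ∣ I} =
      {I | I ∈ idealsOfNorm (p * h) ∧ Ideal.span {(p : ℤ√2)} ∣ I} := by
    ext I
    rw [← hPQ]
    have h3 := hand I
    have h4 : primeOver p * Q ∣ I → primeOver p ∣ I := (dvd_mul_right _ _).trans
    have h5 : primeOver p * Q ∣ I → Q ∣ I := (dvd_mul_left _ _).trans
    simp only [Set.mem_inter_iff, Set.mem_ofPred_eq]
    tauto
  have hfin := finite_idealsOfNorm (p * h)
  have key := finsum_mem_union_inter (f := fun I => eta I ^ m)
    (s := {I | I ∈ idealsOfNorm (p * h) ∧ primeOver p ∣ I})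
    (t := {I | I ∈ idealsOfNorm (p * h) ∧ Q ∣ I})
    (hfin.subset fun I (hI : I ∈ idealsOfNorm (p * h) ∧ primeOver p ∣ I) => hI.1)
    (hfin.subset fun I (hI : I ∈ idealsOfNorm (p * h) ∧ Q ∣ I) => hI.1)
  rw [hunion, hinter, ← image_mul_idealsOfNorm hP hp.ne_zero,
    ← image_mul_idealsOfNorm hQ hp.ne_zero, finsum_image_mul m (ne_bot_of_absNorm hP hp.ne_zero),
    finsum_image_mul m (ne_bot_of_absNorm hQ hp.ne_zero)] at key
  rw [idealSum, key, lamPrime, if_neg h2, if_pos hchi, zpow_neg, ← inv_zpow,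
    ← eq_inv_of_mul_eq_one_right heta, idealSum]
  ring

/-! #### The Hecke relations -/

theorem idealSum_prime_mul (m : ℤ) {p n : ℕ} (hp : p.Prime) (hpn : ¬ p ∣ n) :
    idealSum m (p * n) = lamPrime m p * idealSum m n := by
  by_cases h2 : p = 2
  · rw [h2, idealSum_two_mul, lamPrime, if_pos rfl]
  by_cases h1 : chi p = 1
  · rw [← idealSum_split m hp h2 h1]
    have : {I | I ∈ idealsOfNorm (p * n) ∧ Ideal.span {(p : ℤ√2)} ∣ I} = ∅ := by
      refine Set.eq_empty_of_forall_notMem ?_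
      rintro _ ⟨hI, J, rfl⟩
      rw [mem_idealsOfNorm, map_mul, absNorm_span_natCast, mul_assoc,
        mul_right_inj' hp.ne_zero] at hI
      exact hpn ⟨_, hI.symm⟩
    rw [this, finsum_mem_empty, add_zero]
  · rw [idealSum_inert_of_not_dvd m hp (chi_eq_neg_one hp h2 h1) hpn, lamPrime, if_neg h2,
      if_neg h1, zero_mul]

theorem idealSum_prime_mul_mul (m : ℤ) {p : ℕ} (hp : p.Prime) (n : ℕ) :
    idealSum m (p * (p * n)) = lamPrime m p * idealSum m (p * n) - chi p * idealSum m n := by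
  by_cases h2 : p = 2
  · rw [h2, idealSum_two_mul m (2 * n), chi_two, lamPrime, if_pos rfl]
    simp
  by_cases h1 : chi p = 1
  · rw [← idealSum_split m hp h2 h1, ← mul_assoc, ← image_mul_idealsOfNorm
      (absNorm_span_natCast p) (mul_ne_zero hp.ne_zero hp.ne_zero), finsum_image_mul m
      (ne_bot_of_absNorm (absNorm_span_natCast p) (mul_ne_zero hp.ne_zero hp.ne_zero)), eta_span,
      etaElt_natCast hp.ne_zero, h1, idealSum, idealSum]
    simp
  · have h3 := chi_eq_neg_one hp h2 h1
    rw [idealSum_inert_mul m hp h3, lamPrime, if_neg h2, if_neg h1, h3]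
    simp

theorem lam_eq_idealSum (m : ℤ) {h : ℕ} (hh : h ≠ 0) : lam m h = idealSum m h := by
  refine lam_eq_of_prime_pow_mul m (idealSum m) (idealSum_one m) (fun p n k hp hpn => ?_) hh
  induction k using Nat.twoStepInduction with
  | zero => simp [lamPrimePow]
  | one => rw [pow_one, idealSum_prime_mul m hp hpn, lamPrimePow]
  | more k ih1 ih2 =>
    have h3 : p ^ (k + 2) * n = p * (p * (p ^ k * n)) := by ring
    have h4 : p * (p ^ k * n) = p ^ (k + 1) * n := by ring
    rw [h3, idealSum_prime_mul_mul m hp, h4, ih1, ih2, lamPrimePow]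
    ring

/-! ### Poisson summation for powers of the hyperbolic secant -/

/-- The substitution `x = σ(t)` by the logistic function `σ` turns the beta integral into an
integral over the real line. -/
theorem betaIntegral_eq_integral_sigmoid (u v : ℂ) : Complex.betaIntegral u v =
    ∫ x : ℝ, (Real.sigmoid x : ℂ) ^ u * (Real.sigmoid (-x) : ℂ) ^ v := by
  have key := MeasureTheory.integral_image_eq_integral_abs_deriv_smul MeasurableSet.univ
    (fun x _ => (Real.hasDerivAt_sigmoid x).hasDerivWithinAt) Real.sigmoid_injective.injOn
    (fun x : ℝ => (x : ℂ) ^ (u - 1) * (1 - (x : ℂ)) ^ (v - 1))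
  rw [Set.image_univ, Real.range_sigmoid] at key
  rw [Complex.betaIntegral, intervalIntegral.integral_of_le zero_le_one,
    MeasureTheory.integral_Ioc_eq_integral_Ioo, key, MeasureTheory.setIntegral_univ]
  congr 1 with x
  have h1 := Real.sigmoid_pos x
  have h2 := Real.sigmoid_pos (-x)
  have h1' : (Real.sigmoid x : ℂ) ≠ 0 := by exact_mod_cast h1.ne'
  have h2' : (Real.sigmoid (-x) : ℂ) ≠ 0 := by exact_mod_cast h2.ne'
  have h3 : (1 : ℂ) - (Real.sigmoid x : ℂ) = (Real.sigmoid (-x) : ℂ) := by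
    rw [Real.sigmoid_neg]; push_cast; rfl
  rw [h3, ← Real.sigmoid_neg, abs_of_pos (mul_pos h1 h2), Complex.real_smul,
    Complex.cpow_sub _ _ h1', Complex.cpow_sub _ _ h2', Complex.cpow_one, Complex.cpow_one]
  push_cast
  field_simp

theorem sigmoid_eq_exp_div_cosh (x : ℝ) :
    Real.sigmoid x = Real.exp (x / 2) * (2 * Real.cosh (x / 2))⁻¹ := by
  rw [Real.sigmoid_def, Real.cosh_eq, mul_div_cancel₀ _ two_ne_zero]
  have h1 : Real.exp (-x) = Real.exp (-(x / 2)) * Real.exp (-(x / 2)) := by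
    rw [← Real.exp_add]; congr 1; ring
  have h2 : Real.exp (x / 2) * Real.exp (-(x / 2)) = 1 := by
    rw [← Real.exp_add]; simp
  have h3 := Real.exp_pos (x / 2)
  have h4 := Real.exp_pos (-(x / 2))
  rw [h1, inv_eq_iff_eq_inv, mul_inv, inv_inv, mul_add, inv_mul_cancel₀ h3.ne',
    inv_eq_of_mul_eq_one_right h2]

theorem sigmoid_cpow (x : ℝ) (u : ℂ) : (Real.sigmoid x : ℂ) ^ u =
    Complex.exp (x / 2 * u) * (((2 * Real.cosh (x / 2))⁻¹ : ℝ) : ℂ) ^ u := by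
  rw [sigmoid_eq_exp_div_cosh, Complex.ofReal_mul, Complex.mul_cpow_ofReal_nonneg
    (Real.exp_pos _).le (inv_nonneg.2 (mul_nonneg zero_le_two (Real.cosh_pos _).le))]
  congr 1
  rw [Complex.cpow_def_of_ne_zero (by exact_mod_cast (Real.exp_pos _).ne'),
    ← Complex.ofReal_log (Real.exp_pos _).le, Real.log_exp]
  push_cast
  rfl

theorem sigmoid_cpow_mul (s : ℂ) (τ x : ℝ) :
    (Real.sigmoid x : ℂ) ^ (s + Complex.I * τ) * (Real.sigmoid (-x) : ℂ) ^ (s - Complex.I * τ) =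
      2 ^ (-2 * s) * (Complex.exp (Complex.I * τ * x) * (Real.cosh (x / 2) : ℂ) ^ (-2 * s)) := by
  have hpos : 0 < 2 * Real.cosh (x / 2) := mul_pos two_pos (Real.cosh_pos _)
  have hne : (((2 * Real.cosh (x / 2))⁻¹ : ℝ) : ℂ) ≠ 0 := by
    exact_mod_cast (inv_pos.2 hpos).ne'
  have harg : ((2 * Real.cosh (x / 2) : ℝ) : ℂ).arg ≠ Real.pi := by
    rw [Complex.arg_ofReal_of_nonneg hpos.le]; exact Real.pi_pos.ne
  have hpow : (((2 * Real.cosh (x / 2))⁻¹ : ℝ) : ℂ) ^ (2 * s) =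
      2 ^ (-2 * s) * (Real.cosh (x / 2) : ℂ) ^ (-2 * s) := by
    rw [Complex.ofReal_inv, Complex.inv_cpow _ _ harg, ← Complex.cpow_neg, Complex.ofReal_mul,
      Complex.mul_cpow_ofReal_nonneg zero_le_two (Real.cosh_pos _).le, neg_mul]
    norm_num
  rw [sigmoid_cpow, sigmoid_cpow, neg_div, Real.cosh_neg, mul_mul_mul_comm, ← Complex.exp_add,
    ← Complex.cpow_add _ _ hne]
  have e1 : s + Complex.I * τ + (s - Complex.I * τ) = 2 * s := by ring
  have e2 : (x : ℂ) / 2 * (s + Complex.I * τ) + ((-x : ℝ) : ℂ) / 2 * (s - Complex.I * τ)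
      = Complex.I * τ * x := by
    push_cast; ring
  rw [e1, e2, hpow]
  ring

/-- The Fourier transform of a power of the hyperbolic secant is a beta integral. -/
theorem betaIntegral_eq_fourier_sech (s : ℂ) (τ : ℝ) :
    Complex.betaIntegral (s + Complex.I * τ) (s - Complex.I * τ) =
      2 ^ (-2 * s) * ∫ x : ℝ,
        Complex.exp (Complex.I * τ * x) * (Real.cosh (x / 2) : ℂ) ^ (-2 * s) := by
  rw [betaIntegral_eq_integral_sigmoid, ← MeasureTheory.integral_const_mul]
  congr 1 with x
  exact sigmoid_cpow_mul s τ x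

/-- The bound does not depend on `τ`. -/
theorem norm_betaIntegral_le (s : ℂ) (τ : ℝ) :
    ‖Complex.betaIntegral (s + Complex.I * τ) (s - Complex.I * τ)‖ ≤
      ‖(2 : ℂ) ^ (-2 * s)‖ * ∫ x : ℝ, ‖(Real.cosh (x / 2) : ℂ) ^ (-2 * s)‖ := by
  rw [betaIntegral_eq_fourier_sech, norm_mul]
  refine mul_le_mul_of_nonneg_left ((MeasureTheory.norm_integral_le_integral_norm _).trans_eq ?_)
    (norm_nonneg _)
  congr 1 with x
  have : Complex.I * τ * x = ((τ * x : ℝ) : ℂ) * Complex.I := by push_cast; ring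
  rw [norm_mul, this, Complex.norm_exp_ofReal_mul_I, one_mul]

theorem Gamma_mul_Gamma_recurrence {s : ℂ} (hs : 0 < s.re) (τ : ℝ) :
    (s ^ 2 + (τ : ℂ) ^ 2) *
        (Complex.Gamma (s + Complex.I * τ) * Complex.Gamma (s - Complex.I * τ)) =
      Complex.Gamma (2 * (s + 1)) *
        Complex.betaIntegral (s + 1 + Complex.I * τ) (s + 1 - Complex.I * τ) := by
  have h1 : s + Complex.I * τ ≠ 0 := fun h => by
    have := congrArg Complex.re h
    simp at this
    exact hs.ne' this
  have h2 : s - Complex.I * τ ≠ 0 := fun h => by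
    have := congrArg Complex.re h
    simp at this
    exact hs.ne' this
  have h3 := Complex.Gamma_mul_Gamma_eq_betaIntegral (s := s + 1 + Complex.I * τ)
    (t := s + 1 - Complex.I * τ) (by simp; linarith) (by simp; linarith)
  have e1 : s + 1 + Complex.I * τ = s + Complex.I * τ + 1 := by ring
  have e2 : s + 1 - Complex.I * τ = s - Complex.I * τ + 1 := by ring
  have e3 : s + 1 + Complex.I * τ + (s + 1 - Complex.I * τ) = 2 * (s + 1) := by ring
  rw [e3] at h3
  rw [← h3, e1, e2, Complex.Gamma_add_one _ h1, Complex.Gamma_add_one _ h2]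
  linear_combination ((τ : ℂ) ^ 2 * Complex.Gamma (s + Complex.I * τ) *
    Complex.Gamma (s - Complex.I * τ)) * Complex.I_sq

/-- Raising `s` to `s + 1` gains the factor `(s² + τ²)⁻¹`, which makes the sum over `τ = c m`
converge. -/
theorem summable_Gamma_mul_Gamma {s : ℂ} (hs : 0 < s.re) {c : ℝ} (hc : c ≠ 0) :
    Summable fun m : ℤ => Complex.Gamma (s + Complex.I * (m * c : ℝ)) *
      Complex.Gamma (s - Complex.I * (m * c : ℝ)) := by
  set K : ℝ := ‖Complex.Gamma (2 * (s + 1))‖ * (‖(2 : ℂ) ^ (-2 * (s + 1))‖ *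
    ∫ x : ℝ, ‖(Real.cosh (x / 2) : ℂ) ^ (-2 * (s + 1))‖) with hK
  have hbound : ∀ m : ℤ, ‖s ^ 2 + ((m * c : ℝ) : ℂ) ^ 2‖ *
      ‖Complex.Gamma (s + Complex.I * (m * c : ℝ)) *
        Complex.Gamma (s - Complex.I * (m * c : ℝ))‖ ≤ K := fun m => by
    rw [← norm_mul, Gamma_mul_Gamma_recurrence hs, norm_mul, hK]
    exact mul_le_mul_of_nonneg_left (norm_betaIntegral_le _ _) (norm_nonneg _)
  have hc2 : 0 < c ^ 2 := by positivity
  refine summable_of_isBigO (Real.summable_one_div_int_pow.2 one_lt_two)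
    (Asymptotics.IsBigO.of_bound (2 * K / c ^ 2) ?_)
  have hlarge : ∀ᶠ m : ℤ in Filter.cofinite, 2 * ‖s‖ ^ 2 / c ^ 2 + 1 ≤ |(m : ℝ)| :=
    (tendsto_norm_cocompact_atTop.comp Int.tendsto_coe_cofinite).eventually_ge_atTop _
  filter_upwards [hlarge] with m hm
  have hR : 0 ≤ 2 * ‖s‖ ^ 2 / c ^ 2 := by positivity
  have hm1 : 1 ≤ |(m : ℝ)| := by linarith
  have hm2 : 0 < (m : ℝ) ^ 2 := by rw [← sq_abs]; positivity
  have hs2 : 2 * ‖s‖ ^ 2 ≤ (m : ℝ) ^ 2 * c ^ 2 := by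
    have : 2 * ‖s‖ ^ 2 / c ^ 2 ≤ (m : ℝ) ^ 2 := by rw [← sq_abs (m : ℝ)]; nlinarith
    rwa [div_le_iff₀ hc2] at this
  have hlow : (m : ℝ) ^ 2 * c ^ 2 / 2 ≤ ‖s ^ 2 + ((m * c : ℝ) : ℂ) ^ 2‖ := by
    have h1 := norm_sub_le (s ^ 2 + ((m * c : ℝ) : ℂ) ^ 2) (s ^ 2)
    rw [add_sub_cancel_left, norm_pow, norm_pow, Complex.norm_real, Real.norm_eq_abs, sq_abs,
      mul_pow] at h1
    linarith
  have h2 := (mul_le_mul_of_nonneg_right hlow (norm_nonneg _)).trans (hbound m)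
  rw [Real.norm_of_nonneg (by positivity), div_mul_div_comm, mul_one,
    le_div_iff₀ (by positivity)]
  linarith

theorem cosh_lower (x : ℝ) : x ^ 2 / 4 ≤ Real.cosh x := by
  have h := Real.quadratic_le_exp_of_nonneg (abs_nonneg x)
  rw [← Real.cosh_abs, Real.cosh_eq]
  have h2 := Real.exp_pos (-|x|)
  rw [sq_abs] at h
  have h3 := abs_nonneg x
  linarith

/-- The function `x ↦ cosh(L x) ^ (-2s)`, to which Poisson summation is applied. -/
noncomputable def sechPow (L : ℝ) (s : ℂ) (x : ℝ) : ℂ := (Real.cosh (L * x) : ℂ) ^ (-2 * s)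

theorem continuous_sechPow (L : ℝ) (s : ℂ) : Continuous (sechPow L s) := by
  refine Continuous.cpow (by fun_prop) continuous_const fun x => Or.inl ?_
  rw [Complex.ofReal_re]
  exact Real.cosh_pos _

theorem isBigO_sechPow {L : ℝ} (hL : 0 < L) {s : ℂ} (hs : 1 < s.re) :
    sechPow L s =O[Filter.cocompact ℝ] fun x => |x| ^ (-2 : ℝ) := by
  refine Asymptotics.IsBigO.of_bound (4 / L ^ 2) ?_
  have hne : ∀ᶠ x : ℝ in Filter.cocompact ℝ, 1 ≤ |x| :=
    (tendsto_norm_cocompact_atTop (E := ℝ)).eventually_ge_atTop 1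
  filter_upwards [hne] with x hx
  have hx0 : 0 < |x| := by linarith
  have h1 := cosh_lower (L * x)
  have hx2 : 0 < x ^ 2 := by rw [← sq_abs]; positivity
  have hpos : 0 < (L * x) ^ 2 / 4 := by rw [mul_pow]; positivity
  rw [sechPow, Complex.norm_cpow_eq_rpow_re_of_pos (Real.cosh_pos _),
    Real.norm_of_nonneg (by positivity), Real.rpow_neg hx0.le, Real.rpow_two, sq_abs]
  calc Real.cosh (L * x) ^ (-2 * s).re ≤ Real.cosh (L * x) ^ (-1 : ℝ) :=
        Real.rpow_le_rpow_of_exponent_le (Real.one_le_cosh _) (by simp; linarith)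
    _ = (Real.cosh (L * x))⁻¹ := Real.rpow_neg_one _
    _ ≤ ((L * x) ^ 2 / 4)⁻¹ := inv_anti₀ hpos h1
    _ = 4 / L ^ 2 * (x ^ 2)⁻¹ := by field_simp

theorem fourier_sechPow {L : ℝ} (hL : 0 < L) {s : ℂ} (hs : 0 < s.re) (m : ℤ) :
    FourierTransform.fourier (sechPow L s) (m : ℝ) =
      2 ^ (2 * s) / (2 * L) * (Complex.Gamma (s + Complex.I * (m * (Real.pi / L) : ℝ)) *
        Complex.Gamma (s - Complex.I * (m * (Real.pi / L) : ℝ)) / Complex.Gamma (2 * s)) := by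
  have hbeta := betaIntegral_eq_fourier_sech s (-(m * (Real.pi / L)))
  have hG := Complex.Gamma_mul_Gamma_eq_betaIntegral (s := s - Complex.I * (m * (Real.pi / L) : ℝ))
    (t := s + Complex.I * (m * (Real.pi / L) : ℝ)) (by simpa using hs) (by simpa using hs)
  have e1 : s - Complex.I * (m * (Real.pi / L) : ℝ) + (s + Complex.I * (m * (Real.pi / L) : ℝ))
      = 2 * s := by ring
  have e2 : s + Complex.I * ((-(m * (Real.pi / L)) : ℝ) : ℂ)
      = s - Complex.I * (m * (Real.pi / L) : ℝ) := by push_cast; ring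
  have e3 : s - Complex.I * ((-(m * (Real.pi / L)) : ℝ) : ℂ)
      = s + Complex.I * (m * (Real.pi / L) : ℝ) := by push_cast; ring
  rw [e2, e3] at hbeta
  rw [e1, hbeta] at hG
  have hGne : Complex.Gamma (2 * s) ≠ 0 := Complex.Gamma_ne_zero_of_re_pos (by simpa using hs)
  have hsub := MeasureTheory.Measure.integral_comp_mul_left (fun x : ℝ =>
    Complex.exp (Complex.I * ((-(m * (Real.pi / L)) : ℝ) : ℂ) * x) *
      (Real.cosh (x / 2) : ℂ) ^ (-2 * s)) (2 * L)
  have h2L : 0 < 2 * L := by positivity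
  rw [abs_of_pos (inv_pos.2 h2L), Complex.real_smul] at hsub
  have hF : FourierTransform.fourier (sechPow L s) (m : ℝ) =
      ∫ x : ℝ, Complex.exp (Complex.I * ((-(m * (Real.pi / L)) : ℝ) : ℂ) * ((2 * L * x : ℝ) : ℂ)) *
        (Real.cosh (2 * L * x / 2) : ℂ) ^ (-2 * s) := by
    rw [Real.fourier_real_eq_integral_exp_smul]
    congr 1 with x
    have e4 : 2 * L * x / 2 = L * x := by ring
    rw [smul_eq_mul, sechPow, e4]
    congr 2
    have hLc : (L : ℂ) ≠ 0 := by exact_mod_cast hL.ne'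
    push_cast
    field_simp
  have h2 : (2 : ℂ) ^ (2 * s) * 2 ^ (-2 * s) = 1 := by
    rw [← Complex.cpow_add _ _ two_ne_zero]; simp
  rw [hF, hsub, mul_comm (Complex.Gamma (s + _)), hG, mul_div_cancel_left₀ _ hGne,
    div_mul_eq_mul_div, ← mul_assoc, h2, one_mul]
  push_cast
  ring

theorem summable_sechPow_add {L : ℝ} (hL : 0 < L) {s : ℂ} (hs : 1 < s.re) (x : ℝ) :
    Summable fun k : ℤ => sechPow L s (x + k) := by
  have hsum : Summable fun k : ℤ => |x + (k : ℝ)| ^ (-2 : ℝ) := by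
    refine ((Real.summable_one_div_int_add_rpow x 2).2 one_lt_two).congr fun k => ?_
    rw [Real.rpow_neg (abs_nonneg _), one_div, add_comm]
  exact summable_of_isBigO hsum ((isBigO_sechPow hL hs).comp_tendsto
    ((Homeomorph.addLeft x).isClosedEmbedding.tendsto_cocompact.comp Int.tendsto_coe_cofinite))

theorem summable_fourier_sechPow {L : ℝ} (hL : 0 < L) {s : ℂ} (hs : 1 < s.re) :
    Summable fun m : ℤ => FourierTransform.fourier (sechPow L s) (m : ℝ) := by
  simp only [fourier_sechPow hL (zero_lt_one.trans hs)]
  exact ((summable_Gamma_mul_Gamma (zero_lt_one.trans hs)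
    (div_pos Real.pi_pos hL).ne').div_const _).mul_left _

/-- Poisson summation for `cosh(L x) ^ (-2s)`, with both sides summable. -/
theorem hasSum_fourier_sechPow {L : ℝ} (hL : 0 < L) {s : ℂ} (hs : 1 < s.re) (x : ℝ) :
    HasSum (fun m : ℤ => FourierTransform.fourier (sechPow L s) (m : ℝ) *
      Complex.exp (2 * Real.pi * Complex.I * m * x)) (∑' k : ℤ, sechPow L s (x + k)) := by
  have hsum := summable_fourier_sechPow hL hs
  rw [Real.tsum_eq_tsum_fourier_of_rpow_decay_of_summable (continuous_sechPow L s) one_lt_two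
    (isBigO_sechPow hL hs) hsum x]
  simp only [fourier_coe_apply, Complex.ofReal_one, div_one]
  refine Summable.hasSum (Summable.of_norm (hsum.norm.congr fun m => ?_))
  have : 2 * Real.pi * Complex.I * m * x = ((2 * Real.pi * m * x : ℝ) : ℂ) * Complex.I := by
    push_cast; ring
  rw [norm_mul, this, Complex.norm_exp_ofReal_mul_I, mul_one]

/-! ### Elements of norm `-h` -/

/-- Half the logarithm of `|α / α'|`, the coordinate on the norm hyperbola. -/
noncomputable def halfLog (α : ℤ√2) : ℝ := Real.log |place₁ α / place₂ α| / 2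

theorem halfLog_mul {α β : ℤ√2} (hα : α ≠ 0) (hβ : β ≠ 0) :
    halfLog (α * β) = halfLog α + halfLog β := by
  have hne : ∀ {γ : ℤ√2}, γ ≠ 0 → |place₁ γ / place₂ γ| ≠ 0 := fun h =>
    abs_ne_zero.2 (div_ne_zero (place₁_ne_zero h) (place₂_ne_zero h))
  rw [halfLog, map_mul, map_mul, mul_div_mul_comm, abs_mul, Real.log_mul (hne hα) (hne hβ),
    add_div, halfLog, halfLog]

theorem map_zpow_unit (f : ℤ√2 →+* ℝ) (u : (ℤ√2)ˣ) (k : ℤ) :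
    f ((u ^ k : (ℤ√2)ˣ) : ℤ√2) = f u ^ k := by
  have h := congrArg Units.val (map_zpow (Units.map (f : ℤ√2 →* ℝ)) u k)
  rwa [Units.val_zpow_eq_zpow_val] at h

theorem halfLog_fundUnit_zpow (k : ℤ) :
    halfLog (((fundUnit ^ 2) ^ k : (ℤ√2)ˣ) : ℤ√2) = k * (2 * Real.log (1 + √2)) := by
  rw [halfLog, map_zpow_unit, map_zpow_unit, ← div_zpow, abs_zpow, Real.log_zpow,
    Units.val_pow_eq_pow_val, map_pow, map_pow, ← div_pow, abs_pow, Real.log_pow,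
    log_place_fundUnit]
  push_cast
  ring

theorem halfLog_sign (e : ℤˣ) : halfLog ((e : ℤ) : ℤ√2) = 0 := by
  rcases Int.units_eq_one_or e with rfl | rfl <;> simp [halfLog]

/-- On the hyperbola of norm `-h`, the coordinate `b` of `a + b√2` satisfies
`2 b² = h cosh² u` with `u` half the logarithm of `|α / α'|`. -/
theorem im_sq_eq {α : ℤ√2} {h : ℕ} (hh : h ≠ 0) (hα : α.norm = -h) :
    (α.im : ℝ) ^ 2 = h / 2 * Real.cosh (halfLog α) ^ 2 := by
  have hh' : (0 : ℝ) < h := by exact_mod_cast hh.bot_lt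
  have hab : place₁ α * place₂ α = -h := by rw [place_mul_place, hα]; push_cast; rfl
  have hα0 : α ≠ 0 := by
    rintro rfl
    rw [Zsqrtd.norm_zero] at hα
    omega
  have ha := place₁_ne_zero hα0
  have hb := place₂_ne_zero hα0
  have hneg : place₁ α / place₂ α < 0 := by
    rw [div_eq_mul_inv, ← mul_self_mul_inv (place₂ α)⁻¹, inv_inv]
    have : place₁ α * ((place₂ α)⁻¹ * (place₂ α)⁻¹ * place₂ α)
      = place₁ α * place₂ α * ((place₂ α)⁻¹) ^ 2 := by ring
    rw [this, hab]
    have := pow_pos (abs_pos.2 (inv_ne_zero hb)) 2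
    rw [sq_abs] at this
    nlinarith
  have hexp : Real.exp (2 * halfLog α) = -(place₁ α / place₂ α) := by
    rw [halfLog, mul_div_cancel₀ _ two_ne_zero, Real.exp_log (abs_pos.2 hneg.ne), abs_of_neg hneg]
  have hexp' : Real.exp (-(2 * halfLog α)) = -(place₂ α / place₁ α) := by
    rw [Real.exp_neg, hexp, inv_neg, inv_div]
  have hcosh : Real.cosh (halfLog α) ^ 2 = (Real.cosh (2 * halfLog α) + 1) / 2 := by
    rw [Real.cosh_two_mul, Real.sinh_sq]; ring
  have hdiff : place₁ α - place₂ α = 2 * α.im * √2 := by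
    rw [place₁_apply, place₂_apply]; ring
  have hsq : (place₁ α - place₂ α) ^ 2 = 8 * (α.im : ℝ) ^ 2 := by
    rw [hdiff, mul_pow, Real.sq_sqrt zero_le_two]; ring
  have h1 : (h : ℝ) * (place₁ α / place₂ α) = -place₁ α ^ 2 := by
    rw [← neg_eq_iff_eq_neg.2 hab]; field_simp
  have h2 : (h : ℝ) * (place₂ α / place₁ α) = -place₂ α ^ 2 := by
    rw [← neg_eq_iff_eq_neg.2 hab]; field_simp
  rw [hcosh, Real.cosh_eq, hexp, hexp']
  linear_combination (-1 / 8) * hsq + (1 / 8) * h1 + (1 / 8) * h2 - (1 / 4) * hab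

/-- The contribution of `α = a + b√2` of norm `-h` to the Dirichlet series, namely
`(b²) ^ (-s)`. -/
noncomputable def elementTerm (s : ℂ) (α : ℤ√2) : ℂ := (((α.im : ℝ) ^ 2 : ℝ) : ℂ) ^ (-s)

theorem elementTerm_eq {α : ℤ√2} {h : ℕ} (hh : h ≠ 0) (hα : α.norm = -h) (s : ℂ) {L : ℝ}
    (hL : 0 < L) :
    elementTerm s α = ((h / 2 : ℝ) : ℂ) ^ (-s) * sechPow L s (halfLog α / L) := by
  have hc := Real.cosh_pos (halfLog α)
  rw [elementTerm, im_sq_eq hh hα, Complex.ofReal_mul, Complex.mul_cpow_ofReal_nonneg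
    (by positivity) (by positivity), sechPow, mul_div_cancel₀ _ hL.ne']
  congr 1
  have h1 : -2 * s = -s + -s := by ring
  rw [h1, Complex.cpow_add _ _ (by exact_mod_cast hc.ne'), sq, Complex.ofReal_mul,
    Complex.mul_cpow_ofReal_nonneg hc.le hc.le]

theorem exists_generator_norm_neg {h : ℕ} {I : Ideal (ℤ√2)} (hI : I ∈ idealsOfNorm h) :
    ∃ α : ℤ√2, Ideal.span {α} = I ∧ α.norm = -h := by
  have hspan := Ideal.span_singleton_generator I
  set β := Submodule.IsPrincipal.generator I
  rw [← hspan, span_mem_idealsOfNorm] at hI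
  rcases Int.natAbs_eq β.norm with h1 | h1
  · refine ⟨β * fundUnit, ?_, by rw [Zsqrtd.norm_mul, norm_fundUnit, h1, hI]; ring⟩
    rw [← hspan, Ideal.span_singleton_eq_span_singleton]
    exact associated_mul_unit_left β _ fundUnit.isUnit
  · exact ⟨β, hspan, by rw [h1, hI]⟩

theorem place₁_fundUnit_zpow_pos (k : ℤ) :
    0 < place₁ (((fundUnit ^ 2) ^ k : (ℤ√2)ˣ) : ℤ√2) := by
  rw [map_zpow_unit, Units.val_pow_eq_pow_val, map_pow, place₁_fundUnit]
  positivity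

/-- Every element of norm `-h` is uniquely `±(1 + √2) ^ (2k)` times the chosen generator of norm
`-h` of the ideal it generates. -/
theorem exists_equiv_elements {h : ℕ} (hh : h ≠ 0) : ∃ (g : idealsOfNorm h → ℤ√2)
    (Φ : (idealsOfNorm h × ℤˣ) × ℤ ≃ {α : ℤ√2 // α.norm = -h}),
    (∀ I, Ideal.span {g I} = I ∧ (g I).norm = -h) ∧
    ∀ I e k, (Φ ((I, e), k) : ℤ√2) =
      ((e : ℤ) : ℤ√2) * (((fundUnit ^ 2) ^ k : (ℤ√2)ˣ) : ℤ√2) * g I := by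
  choose g hg using fun I : idealsOfNorm h => exists_generator_norm_neg I.2
  have hg0 : ∀ I, g I ≠ 0 := fun I h0 => by
    have := (hg I).2
    rw [h0, Zsqrtd.norm_zero] at this
    omega
  have hsign : ∀ e : ℤˣ, (((e : ℤ) : ℤ√2)).norm = 1 := fun e => by
    rcases Int.units_eq_one_or e with rfl | rfl <;> simp [Zsqrtd.norm_def]
  have hunit : ∀ k : ℤ, ((((fundUnit ^ 2) ^ k : (ℤ√2)ˣ) : ℤ√2)).norm = 1 := fun k => by
    have h1 : Units.map (Zsqrtd.normMonoidHom (d := 2)) (fundUnit ^ 2) = 1 := by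
      ext
      simp [Zsqrtd.normMonoidHom]
    have h2 := map_zpow (Units.map (Zsqrtd.normMonoidHom (d := 2))) (fundUnit ^ 2) k
    rw [h1, one_zpow] at h2
    exact congrArg Units.val h2
  let φ : (idealsOfNorm h × ℤˣ) × ℤ → {α : ℤ√2 // α.norm = -h} := fun x =>
    ⟨((x.1.2 : ℤ) : ℤ√2) * (((fundUnit ^ 2) ^ x.2 : (ℤ√2)ˣ) : ℤ√2) * g x.1.1, by
      rw [Zsqrtd.norm_mul, Zsqrtd.norm_mul, hsign, hunit, (hg _).2, one_mul, one_mul]⟩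
  have hassoc : ∀ x, Ideal.span {(φ x : ℤ√2)} = x.1.1 := fun x => by
    rw [← (hg x.1.1).1, Ideal.span_singleton_eq_span_singleton]
    refine associated_unit_mul_left _ _ (IsUnit.mul ?_ (Units.isUnit _))
    exact (x.1.2.isUnit).map (Int.castRingHom (ℤ√2))
  have hinj : Function.Injective φ := by
    rintro ⟨⟨I, e⟩, k⟩ ⟨⟨J, f⟩, l⟩ hxy
    have hIJ : I = J := by
      have h1 := hassoc ((I, e), k)
      rw [hxy, hassoc] at h1
      exact Subtype.ext h1.symm
    subst hIJ
    have h1 := congrArg place₁ (mul_right_cancel₀ (hg0 I) (congrArg Subtype.val hxy))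
    have hk := place₁_fundUnit_zpow_pos k
    have hl := place₁_fundUnit_zpow_pos l
    rw [map_mul, map_mul] at h1
    have hef : e = f := by
      rcases Int.units_eq_one_or e with rfl | rfl <;> rcases Int.units_eq_one_or f with rfl | rfl
      · rfl
      · simp at h1; linarith
      · simp at h1; linarith
      · rfl
    subst hef
    have he : place₁ ((e : ℤ) : ℤ√2) ≠ 0 := by
      rcases Int.units_eq_one_or e with rfl | rfl <;> simp
    have h2 := mul_left_cancel₀ he h1
    rw [map_zpow_unit, map_zpow_unit, Units.val_pow_eq_pow_val, map_pow, place₁_fundUnit] at h2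
    have hs : (0 : ℝ) < √2 := by positivity
    have h3 : (1 : ℝ) < (1 + √2) ^ 2 := one_lt_pow₀ (by linarith) two_ne_zero
    have h4 : k = l := zpow_right_injective₀ (by positivity) h3.ne' h2
    rw [h4]
  have hsurj : Function.Surjective φ := by
    rintro ⟨α, hα⟩
    have hI : Ideal.span {α} ∈ idealsOfNorm h := by
      rw [span_mem_idealsOfNorm, hα, Int.natAbs_neg, Int.natAbs_natCast]
    obtain ⟨u, hu⟩ := Ideal.span_singleton_eq_span_singleton.1 (hg ⟨_, hI⟩).1
    have hun : (u : ℤ√2).norm = 1 := by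
      have h1 := congrArg Zsqrtd.norm hu
      rw [Zsqrtd.norm_mul, (hg _).2, hα] at h1
      have h2 : (-(h : ℤ)) ≠ 0 := by omega
      exact mul_left_cancel₀ h2 (by rw [h1, mul_one])
    obtain ⟨k, rfl | rfl⟩ := unit_eq_of_norm_one u hun
    · refine ⟨((⟨_, hI⟩, 1), k), Subtype.ext (Eq.trans ?_ hu)⟩
      simp [φ, mul_comm]
    · refine ⟨((⟨_, hI⟩, -1), k), Subtype.ext (Eq.trans ?_ hu)⟩
      simp [φ, mul_comm]
  exact ⟨g, Equiv.ofBijective φ ⟨hinj, hsurj⟩, hg, fun _ _ _ => rfl⟩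

/-! ### The Dirichlet series as a sum over elements of norm `-h` -/

theorem finite_sq_eq {n : ℤ} : {x : ℤ | x ^ 2 = n}.Finite := by
  refine (Set.finite_Icc (-|n|) |n|).subset fun x (hx : x ^ 2 = n) => ?_
  rw [Set.mem_Icc, ← abs_le, ← hx, abs_pow]
  rcases eq_or_ne x 0 with rfl | h
  · simp
  · exact le_self_pow₀ (Int.one_le_abs h) two_ne_zero

/-- The integer `m = b²` to whose term the element `a + b√2` of norm `-h` contributes. It is
positive because `a² = -h` has no solution. -/
def imSq {h : ℕ} (hh : h ≠ 0) (α : {α : ℤ√2 // α.norm = -h}) : ℕ+ :=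
  ⟨(α.1.im ^ 2).toNat, by
    have h1 := α.2
    rw [Zsqrtd.norm_def] at h1
    have h2 : α.1.im ≠ 0 := fun h0 => by
      rw [h0] at h1
      have := mul_self_nonneg α.1.re
      omega
    have : 0 < α.1.im ^ 2 := by positivity
    omega⟩

theorem imSq_eq_iff {h : ℕ} (hh : h ≠ 0) (α : {α : ℤ√2 // α.norm = -h}) (m : ℕ+) :
    imSq hh α = m ↔ α.1.im ^ 2 = (m : ℕ) := by
  rw [← PNat.coe_inj]
  have : 0 ≤ α.1.im ^ 2 := sq_nonneg _
  change (α.1.im ^ 2).toNat = (m : ℕ) ↔ _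
  omega

/-- The elements of norm `-h` contributing to `m` are the pairs counted by `r₁(m) r₁(2m - h)`. -/
def fiberEquiv {h : ℕ} (hh : h ≠ 0) (m : ℕ+) :
    {α : {α : ℤ√2 // α.norm = -h} // imSq hh α = m} ≃
      ({x : ℤ | x ^ 2 = (m : ℕ)} ×ˢ {y : ℤ | y ^ 2 = 2 * ((m : ℕ) : ℤ) - h} : Set (ℤ × ℤ)) where
  toFun α := ⟨(α.1.1.im, α.1.1.re), by
    have h1 := (imSq_eq_iff hh α.1 m).1 α.2
    have h2 := α.1.2
    rw [Zsqrtd.norm_def] at h2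
    refine ⟨h1, ?_⟩
    change α.1.1.re ^ 2 = _
    rw [← h1]; linarith⟩
  invFun x := ⟨⟨⟨x.1.2, x.1.1⟩, by
    have h1 : x.1.1 ^ 2 = (m : ℕ) := x.2.1
    have h2 : x.1.2 ^ 2 = 2 * ((m : ℕ) : ℤ) - h := x.2.2
    rw [Zsqrtd.norm_def]
    change x.1.2 * x.1.2 - 2 * x.1.1 * x.1.1 = _
    linarith⟩, (imSq_eq_iff hh _ m).2 x.2.1⟩
  left_inv _ := rfl
  right_inv _ := rfl

theorem hasSum_seriesTerm {h : ℕ} (hh : h ≠ 0) {s a : ℂ}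
    (H : HasSum (fun α : {α : ℤ√2 // α.norm = -h} => elementTerm s α) a) :
    HasSum (seriesTerm h s) a := by
  refine ((Equiv.sigmaFiberEquiv (imSq hh)).hasSum_iff.2 H).sigma fun m => ?_
  have hfin : Finite ({x : ℤ | x ^ 2 = (m : ℕ)} ×ˢ {y : ℤ | y ^ 2 = 2 * ((m : ℕ) : ℤ) - h} :
      Set (ℤ × ℤ)) := (finite_sq_eq.prod finite_sq_eq).to_subtype
  have : Finite {α : {α : ℤ√2 // α.norm = -h} // imSq hh α = m} :=
    Finite.of_equiv _ (fiberEquiv hh m).symm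
  have := Fintype.ofFinite {α : {α : ℤ√2 // α.norm = -h} // imSq hh α = m}
  have hconst : ∀ c : {α : {α : ℤ√2 // α.norm = -h} // imSq hh α = m},
      elementTerm s c.1.1 = ((m : ℕ) : ℂ) ^ (-s) := fun c => by
    have h1 := (imSq_eq_iff hh c.1 m).1 c.2
    have h2 : ((c.1.1.im : ℝ) ^ 2 : ℝ) = ((m : ℕ) : ℝ) := by exact_mod_cast h1
    rw [elementTerm, h2, Complex.ofReal_natCast]
  have hcard : Fintype.card {α : {α : ℤ√2 // α.norm = -h} // imSq hh α = m} =
      r1 ((m : ℕ) : ℤ) * r1 (2 * ((m : ℕ) : ℤ) - h) := by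
    rw [← Nat.card_eq_fintype_card, Nat.card_congr (fiberEquiv hh m), r1, r1, ← Set.ncard_prod]
    rfl
  have hs := hasSum_fintype fun c : {α : {α : ℤ√2 // α.norm = -h} // imSq hh α = m} =>
    elementTerm s c.1.1
  have hsum : ∑ c : {α : {α : ℤ√2 // α.norm = -h} // imSq hh α = m}, elementTerm s c.1.1 =
      seriesTerm h s m := by
    simp only [hconst, Finset.sum_const, Finset.card_univ, hcard]
    rw [seriesTerm, Complex.cpow_neg, nsmul_eq_mul]
    push_cast
    rw [div_eq_mul_inv]
  rw [← hsum]
  exact hs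

/-! ### The spectral expansion -/

/-- The additive character of the Poisson sum is the value of the Hecke character. -/
theorem exp_halfLog_eq {α : ℤ√2} (hα : α.norm < 0) (m : ℤ) :
    Complex.exp (2 * Real.pi * Complex.I * m *
      ((halfLog α / (2 * Real.log (1 + √2)) : ℝ) : ℂ)) = (-1) ^ m * etaElt α ^ m := by
  have hl : (Real.log (1 + √2) : ℂ) ≠ 0 := by exact_mod_cast log_one_add_sqrt_two_pos.ne'
  rw [← mul_zpow, etaElt_of_norm_neg hα, neg_one_mul, neg_neg, ← Complex.exp_int_mul, halfLog]
  congr 1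
  push_cast
  field_simp

theorem specParam_eq (m : ℤ) :
    specParam m = m * (Real.pi / (2 * Real.log (1 + √2))) := by
  rw [specParam, mul_div_assoc]

/-- The constants of the Poisson formula and of the spectral expansion agree. -/
theorem fourier_sechPow_mul_eq {h : ℕ} (hh : h ≠ 0) {s : ℂ} (hs : 0 < s.re) (m : ℤ) :
    2 * (((h / 2 : ℝ) : ℂ) ^ (-s) *
      FourierTransform.fourier (sechPow (2 * Real.log (1 + √2)) s) (m : ℝ)) =
    1 / (h : ℂ) ^ s *
      (Complex.Gamma (s + Complex.I * specParam m) * Complex.Gamma (s - Complex.I * specParam m) /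
      (2 ^ (1 - 3 * s) * Real.log (1 + √2) * Complex.Gamma (2 * s))) := by
  have hlpos := log_one_add_sqrt_two_pos
  have hl : (Real.log (1 + √2) : ℂ) ≠ 0 := by exact_mod_cast hlpos.ne'
  have hG : Complex.Gamma (2 * s) ≠ 0 := Complex.Gamma_ne_zero_of_re_pos (by simpa using hs)
  have hhs : (h : ℂ) ^ s ≠ 0 := by simp [Complex.cpow_eq_zero_iff, hh]
  have h2 : (2 : ℂ) ^ (1 - 3 * s) ≠ 0 := by simp [Complex.cpow_eq_zero_iff]
  have hpow : ((h / 2 : ℝ) : ℂ) ^ (-s) = 2 ^ s / (h : ℂ) ^ s := by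
    have h3 : ((h / 2 : ℝ) : ℂ) * ((2 : ℝ) : ℂ) = ((h : ℝ) : ℂ) := by push_cast; ring
    have h4 : ((h : ℝ) : ℂ) ^ s = ((h / 2 : ℝ) : ℂ) ^ s * ((2 : ℝ) : ℂ) ^ s := by
      rw [← h3, Complex.mul_cpow_ofReal_nonneg (by positivity) zero_le_two]
    have h5 : ((h / 2 : ℝ) : ℂ) ^ s ≠ 0 := by simp [Complex.cpow_eq_zero_iff, hh]
    have h6 : (2 : ℂ) ^ s ≠ 0 := by simp [Complex.cpow_eq_zero_iff]
    rw [Complex.ofReal_natCast, Complex.ofReal_ofNat] at h4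
    rw [h4, Complex.cpow_neg]
    field_simp
  have h7 : (2 : ℂ) ^ s * 2 ^ (2 * s) * 2 ^ (1 - 3 * s) = 2 := by
    rw [← Complex.cpow_add _ _ two_ne_zero, ← Complex.cpow_add _ _ two_ne_zero]
    have : s + 2 * s + (1 - 3 * s) = 1 := by ring
    rw [this, Complex.cpow_one]
  rw [fourier_sechPow (by positivity) hs, ← specParam_eq, hpow]
  push_cast
  generalize (2 : ℂ) ^ (1 - 3 * s) = E at h2 h7 ⊢
  field_simp
  linear_combination (Complex.Gamma (s + Complex.I * specParam m) *
    Complex.Gamma (s - Complex.I * specParam m)) * h7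

theorem hasSum_seriesTerm_and_spectralTerm {h : ℕ} (hh : h ≠ 0) {s : ℂ} (hs : 1 < s.re) :
    ∃ a, HasSum (seriesTerm h s) a ∧ HasSum (spectralTerm h s) a := by
  set L : ℝ := 2 * Real.log (1 + √2) with hL
  have hLpos : 0 < L := mul_pos two_pos log_one_add_sqrt_two_pos
  obtain ⟨g, Φ, hg, hΦ⟩ := exists_equiv_elements hh
  have : Fintype (idealsOfNorm h) := (finite_idealsOfNorm h).fintype
  have hg0 : ∀ I, g I ≠ 0 := fun I h0 => by
    have := (hg I).2
    rw [h0, Zsqrtd.norm_zero] at this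
    omega
  have hterm : ∀ x : (idealsOfNorm h × ℤˣ) × ℤ, elementTerm s (Φ x) =
      ((h / 2 : ℝ) : ℂ) ^ (-s) * sechPow L s (halfLog (g x.1.1) / L + x.2) := by
    rintro ⟨⟨I, e⟩, k⟩
    rw [elementTerm_eq hh (Φ ((I, e), k)).2 s hLpos, hΦ]
    have he : ((e : ℤ) : ℤ√2) ≠ 0 := by
      rcases Int.units_eq_one_or e with rfl | rfl <;> simp
    rw [halfLog_mul (mul_ne_zero he (Units.ne_zero _)) (hg0 I), halfLog_mul he (Units.ne_zero _),
      halfLog_sign, halfLog_fundUnit_zpow, ← hL]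
    congr 2
    field_simp
    ring
  have hsummable : Summable fun x : (idealsOfNorm h × ℤˣ) × ℤ => elementTerm s (Φ x) := by
    refine Summable.of_norm ((summable_prod_of_nonneg fun _ => norm_nonneg _).2
      ⟨fun i => ?_, (hasSum_fintype _).summable⟩)
    simp only [hterm]
    exact ((summable_sechPow_add hLpos hs _).mul_left _).norm
  have hfiber : ∀ i : idealsOfNorm h × ℤˣ,
      HasSum (fun k : ℤ => elementTerm s (Φ (i, k)))
        (((h / 2 : ℝ) : ℂ) ^ (-s) * ∑' k : ℤ, sechPow L s (halfLog (g i.1) / L + k)) := by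
    intro i
    simp only [hterm]
    exact (summable_sechPow_add hLpos hs _).hasSum.mul_left _
  have htotal := hsummable.hasSum.prod_fiberwise hfiber
  refine ⟨_, hasSum_seriesTerm hh (Φ.hasSum_iff.1 hsummable.hasSum), ?_⟩
  rw [htotal.unique (hasSum_fintype _)]
  have hpoisson := hasSum_sum (s := Finset.univ) fun (i : idealsOfNorm h × ℤˣ) _ =>
    (hasSum_fourier_sechPow hLpos hs (halfLog (g i.1) / L)).mul_left (((h / 2 : ℝ) : ℂ) ^ (-s))
  refine (funext fun m => ?_ : spectralTerm h s = _) ▸ hpoisson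
  have hsummand : ∀ i : idealsOfNorm h × ℤˣ, ((h / 2 : ℝ) : ℂ) ^ (-s) *
      (FourierTransform.fourier (sechPow L s) (m : ℝ) *
        Complex.exp (2 * Real.pi * Complex.I * m * ((halfLog (g i.1) / L : ℝ) : ℂ))) =
      ((h / 2 : ℝ) : ℂ) ^ (-s) * FourierTransform.fourier (sechPow L s) (m : ℝ) * (-1) ^ m *
        eta i.1 ^ m := fun i => by
    rw [hL, exp_halfLog_eq (by rw [(hg i.1).2]; omega), ← eta_span, (hg i.1).1]
    ring
  have hlam : lam m h = ∑ I : idealsOfNorm h, eta I ^ m := by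
    rw [lam_eq_idealSum m hh, idealSum, ← finsum_set_coe_eq_finsum_mem,
      finsum_eq_sum_of_fintype]
  simp only [hsummand]
  rw [← Finset.mul_sum, Fintype.sum_prod_type]
  -- Each ideal is counted twice, once for either sign of the generator.
  simp only [Finset.sum_const, Finset.card_univ, Fintype.card_units_int, nsmul_eq_mul]
  rw [← Finset.mul_sum, ← hlam, spectralTerm]
  have hconst := fourier_sechPow_mul_eq hh (zero_lt_one.trans hs) m
  rw [← hL] at hconst
  push_cast at hconst ⊢
  linear_combination (-((-1) ^ m * lam m h)) * hconst

/-- The term at `m = 0`, by the duplication formula for `Γ`. -/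
theorem spectralTerm_zero {h : ℕ} (hh : h ≠ 0) {s : ℂ} (hs : 0 < s.re) :
    spectralTerm h s 0 =
      2 ^ s * (√Real.pi : ℂ) * (∑ d ∈ h.divisors, (chi d : ℂ)) * Complex.Gamma s /
        (Real.log (1 + √2) * (h : ℂ) ^ s * Complex.Gamma (s + 1 / 2)) := by
  have hl : (Real.log (1 + √2) : ℂ) ≠ 0 := by exact_mod_cast log_one_add_sqrt_two_pos.ne'
  have hG2 : Complex.Gamma (2 * s) ≠ 0 := Complex.Gamma_ne_zero_of_re_pos (by simpa using hs)
  have hGh : Complex.Gamma (s + 1 / 2) ≠ 0 :=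
    Complex.Gamma_ne_zero_of_re_pos (by simp; linarith)
  have hhs : (h : ℂ) ^ s ≠ 0 := by simp [Complex.cpow_eq_zero_iff, hh]
  have h3 : (2 : ℂ) ^ (1 - 3 * s) ≠ 0 := by simp [Complex.cpow_eq_zero_iff]
  have hpow : (2 : ℂ) ^ (1 - 2 * s) = 2 ^ s * 2 ^ (1 - 3 * s) := by
    rw [← Complex.cpow_add _ _ two_ne_zero]
    congr 1; ring
  have hdup := Complex.Gamma_mul_Gamma_add_half s
  rw [hpow] at hdup
  rw [spectralTerm, lam_zero hh]
  simp only [specParam, Int.cast_zero, zero_mul, zero_div, Complex.ofReal_zero, mul_zero, add_zero,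
    sub_zero, zpow_zero, one_mul]
  generalize (2 : ℂ) ^ (1 - 3 * s) = E at h3 hdup ⊢
  generalize Complex.Gamma (s + 1 / 2) = G at hGh hdup ⊢
  field_simp
  linear_combination (∑ d ∈ h.divisors, (chi d : ℂ)) * Complex.Gamma s * hdup

end DihedralSeries

theorem theorem4p1 :
    (∃ σ₀ : ℝ, ∀ h : ℕ, 1 ≤ h → ∀ s : ℂ, σ₀ < s.re →
      Summable (DihedralSeries.seriesTerm h s) ∧
      HasSum (DihedralSeries.spectralTerm h s) (DihedralSeries.D h s) ∧
      DihedralSeries.spectralTerm h s 0 =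
        2 ^ s * (√Real.pi : ℂ) * (∑ d ∈ h.divisors, (DihedralSeries.chi d : ℂ)) *
            Complex.Gamma s /
          (Real.log (1 + √2) * (h : ℂ) ^ s * Complex.Gamma (s + 1 / 2))) ∧
    (∀ (m : ℤ) (h : ℕ), 1 ≤ h →
      {𝔟 : Ideal (ℤ√2) | Nat.card (ℤ√2 ⧸ 𝔟) = h}.Finite ∧
      DihedralSeries.lam m h =
        ∑ᶠ 𝔟 ∈ {𝔟 : Ideal (ℤ√2) | Nat.card (ℤ√2 ⧸ 𝔟) = h}, DihedralSeries.eta 𝔟 ^ m) := by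
  refine ⟨⟨1, fun h hh s hs => ?_⟩, fun m h hh =>
    ⟨DihedralSeries.finite_idealsOfNorm h, DihedralSeries.lam_eq_idealSum m (by omega)⟩⟩
  have hh0 : h ≠ 0 := by omega
  obtain ⟨a, h1, h2⟩ := DihedralSeries.hasSum_seriesTerm_and_spectralTerm hh0 hs
  refine ⟨h1.summable, ?_, DihedralSeries.spectralTerm_zero hh0 (zero_lt_one.trans hs)⟩
  rwa [DihedralSeries.D, h1.tsum_eq]
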